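/- Let $M$ be a smooth manifold (finite-dimensional, without boundary, Hausdorff), let $\nu$ be a presymplectic form on $M$, i.e. a smooth closed 2-form, and assume that $\ker\nu$ has constant rank $m$; then $\ker\nu$ is integrable, and its maximal connected integral manifolds are called the leaves. Let $H\in C^\infty(M)$, and consider the presymplectic equation for curves $\gamma$ in $M$, $$\nu(\dot\gamma(t),\cdot)=\mathrm{d}H(\gamma(t)).\qquad(1)$$ Let $$M_H=\{\,x\in M:\ \mathrm{d}H(x)\in\nu(T_xM)\,\}$$ be the hidden constraint set, where $\nu(T_xM)=\{\nu_x(X,\cdot):X\in T_xM\}$. Assume that, for every leaf $F$, all critical points of the restriction $H|_F$ are nondegenerate. Then: 1. $M_H$ is a (smooth, embedded) submanifold of $M$, of dimension $\dim M-m$ (possibly empty). 2. $T_xM=T_xM_H\oplus\ker\nu_x$ at every $x\in M_H$. The restriction (pullback) of $\nu$ to $M_H$ is a symplectic form, so that $M_H$ is a symplectic manifold. 3. For every $x\in M_H$ and $t_0\in\mathbb{R}$, equation (1) has a smooth solution with $\gamma(t_0)=x$ on some open interval around $t_0$, and any two solutions of (1) on the same open interval that agree at one time are equal. Moreover, a curve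 on an open interval is a solution of (1) if and only if it takes values in $M_H$ and, as a curve in $M_H$, solves Hamilton's equation of the function $H|_{M_H}$ on the symplectic manifold $(M_H,\nu|_{M_H})$. -/

import Mathlib

open Set Manifold
open scoped ContDiff

noncomputable section

namespace Presymplectic

section Forms

variable {V : Type*} [NormedAddCommGroup V] [NormedSpace ℝ V]
  {N : Type*} [TopologicalSpace N] [ChartedSpace V N]

/-- A (not necessarily smooth) differential 2-form on a manifold `N` without boundary modelled on
the vector space `V`: an alternating bilinear form on every tangent space. -/
abbrev TwoForm (V : Type*) [NormedAddCommGroup V] [NormedSpace ℝ V]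
    (N : Type*) [TopologicalSpace N] [ChartedSpace V N] :=
  ∀ x : N, (TangentSpace 𝓘(ℝ, V) x) [⋀^Fin 2]→L[ℝ] ℝ

/-- The pullback `f^* η` of a 2-form along a map `f` between manifolds. -/
def TwoForm.pullback {W : Type*} [NormedAddCommGroup W] [NormedSpace ℝ W]
    {P : Type*} [TopologicalSpace P] [ChartedSpace W P]
    (η : TwoForm V N) (f : P → N) : TwoForm W P :=
  fun x ↦ (η (f x)).compContinuousLinearMap (mfderiv 𝓘(ℝ, W) 𝓘(ℝ, V) f x)

/-- The expression of a 2-form in a chart `e`: the 2-form `(e⁻¹)^* η` on the vector space `V`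
(meaningful on `e.target`). -/
def TwoForm.inChart (η : TwoForm V N) (e : OpenPartialHomeomorph N V) : V → V [⋀^Fin 2]→L[ℝ] ℝ :=
  fun y ↦ TwoForm.pullback η (e.symm : V → N) y

/-- A presymplectic form: a smooth closed 2-form. Both conditions are expressed in charts. -/
structure IsPresymplecticForm (η : TwoForm V N) : Prop where
  smooth : ∀ e ∈ atlas V N, ContDiffOn ℝ ∞ (η.inChart e) e.target
  closed : ∀ e ∈ atlas V N, ∀ y ∈ e.target, extDeriv (η.inChart e) y = 0

/-- The kernel of a 2-form at the point `x`: all tangent vectors `u` with `η(u, v) = 0` for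
every tangent vector `v`. -/
def TwoForm.ker (η : TwoForm V N) (x : N) : Submodule ℝ (TangentSpace 𝓘(ℝ, V) x) where
  carrier := {u | ∀ v, η x ![u, v] = 0}
  zero_mem' := fun v ↦ (η x).map_coord_zero 0 rfl
  add_mem' := fun {a b} ha hb v ↦ by
    have h := (η x).toMultilinearMap.cons_add ![v] a b
    exact h.trans (by
      have h1 : (η x).toMultilinearMap (Fin.cons a ![v]) = 0 := ha v
      have h2 : (η x).toMultilinearMap (Fin.cons b ![v]) = 0 := hb v
      rw [h1, h2, add_zero])
  smul_mem' := fun c a ha v ↦ by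
    have h := (η x).toMultilinearMap.cons_smul ![v] c a
    exact h.trans (by
      have h1 : (η x).toMultilinearMap (Fin.cons a ![v]) = 0 := ha v
      rw [h1, smul_zero])

/-- A symplectic form: a smooth closed 2-form that is nondegenerate at every point. -/
structure IsSymplecticForm (η : TwoForm V N) : Prop extends IsPresymplecticForm η where
  nondegenerate : ∀ x, η.ker x = ⊥

/-- The hidden constraint set: the points `x` with `dH(x) ∈ η(T_x N)`, that is, at which the
equation `η(X, ·) = dH(x)` has a solution `X` in the tangent space. -/
def hiddenConstraintSet (η : TwoForm V N) (H : N → ℝ) : Set N :=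
  {x | ∃ X : TangentSpace 𝓘(ℝ, V) x, ∀ v : TangentSpace 𝓘(ℝ, V) x,
    η x ![X, v] = (mfderiv 𝓘(ℝ, V) 𝓘(ℝ, ℝ) H x v : ℝ)}

/-- The curve `γ` is a solution on `J` (in practice an open interval) of the Hamiltonian equation
`η(γ'(t), ·) = dH(γ(t))`. If `η` is presymplectic, this is the presymplectic equation; if `η` is
symplectic, it says that `γ` is an integral curve of the Hamiltonian vector field of `H`. -/
def IsHamiltonianCurveOn (η : TwoForm V N) (H : N → ℝ) (γ : ℝ → N) (J : Set ℝ) : Prop :=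
  ∀ t ∈ J, MDifferentiableAt 𝓘(ℝ, ℝ) 𝓘(ℝ, V) γ t ∧
    ∀ v : TangentSpace 𝓘(ℝ, V) (γ t),
      η (γ t) ![mfderiv 𝓘(ℝ, ℝ) 𝓘(ℝ, V) γ t (1 : ℝ), v] =
        (mfderiv 𝓘(ℝ, V) 𝓘(ℝ, ℝ) H (γ t) v : ℝ)

end Forms

section Leaves

variable {V : Type*} [NormedAddCommGroup V] [NormedSpace ℝ V]
  {N : Type*} [TopologicalSpace N] [ChartedSpace V N]

/-- `p`, restricted to the connected open set `U ⊆ ℝ^m`, is a plaque of the distribution `ker η`: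
an injective smooth immersion whose tangent spaces are the spaces `ker η`. -/
structure IsPlaque (η : TwoForm V N) {m : ℕ} (U : Set (EuclideanSpace ℝ (Fin m)))
    (p : EuclideanSpace ℝ (Fin m) → N) : Prop where
  isOpen : IsOpen U
  isConnected : IsConnected U
  injOn : InjOn p U
  smoothOn : ContMDiffOn 𝓘(ℝ, EuclideanSpace ℝ (Fin m)) 𝓘(ℝ, V) ∞ p U
  immersion : ∀ u ∈ U,
    Function.Injective (mfderiv 𝓘(ℝ, EuclideanSpace ℝ (Fin m)) 𝓘(ℝ, V) p u)
  tangent : ∀ u ∈ U,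
    LinearMap.range (mfderiv 𝓘(ℝ, EuclideanSpace ℝ (Fin m)) 𝓘(ℝ, V) p u).toLinearMap = η.ker (p u)

/-- The leaf through `z` of the foliation tangent to `ker η`, where `ker η` has rank `m`: all points
that can be joined to `z` by a finite chain of plaques, each meeting the next. Its smooth structure
is the one for which the plaques contained in it are local parametrisations. -/
def leaf (η : TwoForm V N) (m : ℕ) (z : N) : Set N :=
  {y | Relation.EqvGen (fun a b : N ↦
    ∃ (U : Set (EuclideanSpace ℝ (Fin m))) (p : EuclideanSpace ℝ (Fin m) → N),
      IsPlaque η U p ∧ a ∈ p '' U ∧ b ∈ p '' U) z y}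

/-- All critical points of the function `f` on the open set `U ⊆ ℝ^m` are nondegenerate: wherever
the differential vanishes, the Hessian bilinear form is nondegenerate. -/
def CriticalPointsNondegenerateOn {m : ℕ} (f : EuclideanSpace ℝ (Fin m) → ℝ)
    (U : Set (EuclideanSpace ℝ (Fin m))) : Prop :=
  ∀ u ∈ U, fderiv ℝ f u = 0 →
    ∀ a : EuclideanSpace ℝ (Fin m), (∀ b, fderiv ℝ (fderiv ℝ f) u a b = 0) → a = 0

/-- The critical points of the restriction of `H` to every leaf of `ker η` (of rank `m`) are
nondegenerate. As usual for functions on a manifold, critical points and their nondegeneracy are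
read off in the local parametrisations of the leaf. -/
def LeafwiseNondegenerate (η : TwoForm V N) (m : ℕ) (H : N → ℝ) : Prop :=
  ∀ (z : N) (U : Set (EuclideanSpace ℝ (Fin m))) (p : EuclideanSpace ℝ (Fin m) → N),
    IsPlaque η U p → p '' U ⊆ leaf η m z → CriticalPointsNondegenerateOn (H ∘ p) U

end Leaves

end Presymplectic

end

/-! Work in a chart and write `h` for the Hamiltonian there. Since ν has constant rank, its kernel
has a smooth frame `S q` with left inverse a fixed projection `π` (`exists_isKernelFrame`). By
skew-symmetry, a covector lies in the image of ν iff it kills the kernel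
(`exists_eq_iff_forall_ker`), so M_H is the zero set of the leafwise differential `G q = dh(q) ∘
S(q)`.

Nondegeneracy makes `G` a submersion along M_H, already in the kernel directions. To see this one
needs an actual leaf through the point. Closedness of ν gives the integrability condition for `S`
(`IsKernelFrame.fderiv_apply_symm`), and the Frobenius theorem `exists_hasFDerivAt_comp` then yields
a plaque `p` with `Dp = S ∘ p`. Along it `d(h ∘ p) = G ∘ p`, so the Hessian of `h ∘ p` is the
derivative of `G` on kernel vectors; at a point of M_H the plaque has a critical point, and the
hypothesis makes this derivative injective (`exists_local_defining_map`).

Slice charts for M_H follow from the inverse function theorem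
(`IsKernelFrame.exists_straightening`), with codimension m. A kernel vector tangent to M_H is killed
by `dG`, hence zero, and a dimension count gives the direct sum (`isCompl_range_kerAt`). A vector of
M_H annihilated by the pullback of ν is then annihilated by all of ν, so it lies in the kernel and
vanishes: the pullback is symplectic.

On M_H both ν(X, ·) and dH vanish on the kernel, so for X tangent to M_H the presymplectic equation
only needs testing on vectors tangent to M_H, where it is Hamilton's equation
(`hamiltonian_pullback_iff`). A solution lies in M_H because its velocity witnesses membership.
Existence and uniqueness are thereby reduced to an ordinary differential equation on M_H. -/

noncomputable section

namespace Presymplectic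

/-! ### Frobenius theorem for total differential equations. -/

section TotalDifferentialEquation

open Metric Filter Topology NNReal

variable {E F : Type*} [NormedAddCommGroup E] [NormedSpace ℝ E]
  [NormedAddCommGroup F] [NormedSpace ℝ F]

/-- Solutions of a smooth total differential equation `Dp(u) = S(p(u))` are smooth. -/
theorem contDiffOn_of_hasFDerivAt_comp {S : E → F →L[ℝ] E} {p : F → E} {U : Set F} {Ω : Set E}
    (hU : IsOpen U) (hS : ContDiffOn ℝ ∞ S Ω) (hmaps : MapsTo p U Ω)
    (hp : ∀ u ∈ U, HasFDerivAt p (S (p u)) u) : ContDiffOn ℝ ∞ p U := by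
  rw [contDiffOn_infty]
  intro k
  induction k with
  | zero =>
    exact contDiffOn_zero.2 fun u hu ↦ (hp u hu).continuousAt.continuousWithinAt
  | succ k ih =>
    push_cast
    rw [contDiffOn_succ_iff_fderiv_of_isOpen hU]
    refine ⟨fun u hu ↦ (hp u hu).differentiableAt.differentiableWithinAt, by simp, ?_⟩
    refine ((hS.of_le (by exact_mod_cast le_top)).comp ih hmaps).congr fun u hu ↦ ?_
    exact (hp u hu).fderiv

/-- An autonomous ordinary differential equation has a solution on `[0, 1]` that stays in a ball on
which the field is Lipschitz and small enough. -/
theorem exists_solution_mem_closedBall [CompleteSpace E] {f : E → E} {x₀ : E} {a : ℝ} {K : ℝ≥0}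
    (ha : 0 ≤ a) (hl : LipschitzOnWith K f (closedBall x₀ a))
    (hb : ∀ x ∈ closedBall x₀ a, ‖f x‖ ≤ a) :
    ∃ α : ℝ → E, α 0 = x₀ ∧ ∀ t ∈ Icc (0 : ℝ) 1, α t ∈ closedBall x₀ a ∧
      HasDerivWithinAt α (f (α t)) (Icc 0 1) t := by
  lift a to ℝ≥0 using ha
  have hf : IsPicardLindelof (fun _ ↦ f) (tmin := 0) (tmax := 1) ⟨0, by simp⟩ x₀ a 0 a K :=
    IsPicardLindelof.of_time_independent hb hl (by simp)
  obtain ⟨α, hα⟩ := ODE.FunSpace.exists_isFixedPt_next hf (x := x₀) (by simp)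
  refine ⟨α.compProj, ?_, fun t ht ↦ ⟨α.compProj_mem_closedBall hf.mul_max_le, ?_⟩⟩
  · have : α.compProj ((⟨0, by simp⟩ : Icc (0 : ℝ) 1) : ℝ) = x₀ := by
      rw [ODE.FunSpace.compProj_val, ← hα, ODE.FunSpace.next_apply₀]
    exact this
  · apply ODE.hasDerivWithinAt_picard_Icc (t₀ := 0) (by simp) hf.continuousOn_uncurry
      α.continuous_compProj.continuousOn (fun _ ht' ↦ α.compProj_mem_closedBall hf.mul_max_le)
      x₀ ht |>.congr_of_mem _ ht
    intro t' ht'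
    nth_rw 1 [← hα]
    rw [ODE.FunSpace.compProj_of_mem ht', ODE.FunSpace.next_apply]

/-- Mean value inequality on the segment, where the derivative differs from its value at `x` by at
most `C * ‖y - x‖`. It supplies the quadratic Taylor remainder in the Frobenius theorem. -/
theorem norm_sub_sub_fderiv_le {G : Type*} [NormedAddCommGroup G] [NormedSpace ℝ G]
    {f : E → G} {s : Set E} {C : ℝ≥0} (hs : Convex ℝ s) (hf : ∀ x ∈ s, DifferentiableAt ℝ f x)
    (hf' : LipschitzOnWith C (fderiv ℝ f) s) {x y : E} (hx : x ∈ s) (hy : y ∈ s) :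
    ‖f y - f x - fderiv ℝ f x (y - x)‖ ≤ C * ‖y - x‖ * ‖y - x‖ := by
  have hseg : segment ℝ x y ⊆ s := hs.segment_subset hx hy
  refine (convex_segment x y).norm_image_sub_le_of_norm_hasFDerivWithin_le' (f' := fderiv ℝ f)
    (fun z hz ↦ (hf z (hseg hz)).hasFDerivAt.hasFDerivWithinAt) (fun z hz ↦ ?_)
    (left_mem_segment ℝ x y) (right_mem_segment ℝ x y)
  refine (hf'.norm_sub_le (hseg hz) hx).trans ?_
  gcongr
  exact norm_sub_le_of_mem_segment hz

set_option maxHeartbeats 1000000 in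
/-- The Frobenius theorem for total differential equations: if `S` is smooth and satisfies the
integrability condition, then `Dp(u) = S(p(u))` has a local solution with prescribed value at `0`. -/
theorem exists_hasFDerivAt_comp [CompleteSpace E] {S : E → F →L[ℝ] E} {Ω : Set E} (hΩ : IsOpen Ω)
    (hS : ContDiffOn ℝ ∞ S Ω)
    (hsymm : ∀ q ∈ Ω, ∀ u v, fderiv ℝ S q (S q v) u = fderiv ℝ S q (S q u) v)
    {x₀ : E} (hx₀ : x₀ ∈ Ω) :
    ∃ r > 0, ∃ p : F → E, p 0 = x₀ ∧ ∀ u ∈ ball (0 : F) r, p u ∈ Ω ∧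
      HasFDerivAt p (S (p u)) u := by
  have hSx : ContDiffAt ℝ ∞ S x₀ := hS.contDiffAt (hΩ.mem_nhds hx₀)
  have hdSx : ContDiffAt ℝ ∞ (fderiv ℝ S) x₀ := hSx.fderiv_right (by simp)
  obtain ⟨K, s, hs, hK⟩ := (hSx.of_le (m := 1) (by simp)).exists_lipschitzOnWith
  obtain ⟨C, s', hs', hC⟩ := (hdSx.of_le (m := 1) (by simp)).exists_lipschitzOnWith
  set L : ℝ := ‖S x₀‖ + 1 with hLdef
  set D : ℝ := ‖fderiv ℝ S x₀‖ + 1 with hDdef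
  have hL : 0 < L := by positivity
  have hD : 0 < D := by positivity
  have hbL : ∀ᶠ q in 𝓝 x₀, ‖S q‖ < L :=
    hSx.continuousAt.norm.eventually_lt_const (by simp [hLdef])
  have hbD : ∀ᶠ q in 𝓝 x₀, ‖fderiv ℝ S q‖ < D :=
    have h : ContinuousAt (fun q ↦ ‖fderiv ℝ S q‖) x₀ :=
      Tendsto.norm (E := E →L[ℝ] F →L[ℝ] E) hdSx.continuousAt
    h.eventually_lt_const (by simp [hDdef])
  obtain ⟨a, ha, hball⟩ := Metric.nhds_basis_closedBall.eventually_iff.1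
    (hbL.and (hbD.and (((eventually_mem_set.2 hs).and (eventually_mem_set.2 hs')).and
      (hΩ.eventually_mem hx₀))))
  set B := closedBall x₀ a with hBdef
  have hKB : LipschitzOnWith K S B := hK.mono fun q hq ↦ (hball hq).2.2.1.1
  have hCB : LipschitzOnWith C (fderiv ℝ S) B := hC.mono fun q hq ↦ (hball hq).2.2.1.2
  have hLB : ∀ q ∈ B, ‖S q‖ ≤ L := fun q hq ↦ (hball hq).1.le
  have hDB : ∀ q ∈ B, ‖fderiv ℝ S q‖ ≤ D := fun q hq ↦ (hball hq).2.1.le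
  have hΩB : B ⊆ Ω := fun q hq ↦ (hball hq).2.2.2
  have hdiff : ∀ q ∈ B, DifferentiableAt ℝ S q := fun q hq ↦
    (hS.contDiffAt (hΩ.mem_nhds (hΩB hq))).differentiableAt (by simp)
  -- For `‖u‖ ≤ r` the field `S(·) u` has norm at most `a / 4`: trajectories stay in the ball of
  -- radius `a / 2`, and a correction of size `a / 4` still keeps the approximate trajectory `z`
  -- below inside `B`.
  set r : ℝ := a / (4 * L) with hrdef
  have hr : 0 < r := by positivity
  have hLr : L * r = a / 4 := by rw [hrdef]; field_simp
  have hsub : closedBall x₀ (a / 2) ⊆ B := closedBall_subset_closedBall (by linarith)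
  have hlip : ∀ v : F, ‖v‖ ≤ r → LipschitzOnWith ((K + 1) * r.toNNReal) (fun q ↦ S q v) B := by
    intro v hv
    refine LipschitzOnWith.of_dist_le_mul fun q hq q' hq' ↦ ?_
    rw [dist_eq_norm, dist_eq_norm, ← sub_apply]
    calc ‖(S q - S q') v‖ ≤ ‖S q - S q'‖ * ‖v‖ := ContinuousLinearMap.le_opNorm _ _
      _ ≤ (K * ‖q - q'‖) * r := by
        gcongr
        exact hKB.norm_sub_le hq hq'
      _ ≤ ((K + 1) * r) * ‖q - q'‖ := by
        have := norm_nonneg (q - q')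
        nlinarith [mul_nonneg hr.le this]
      _ = _ := by simp [hr.le]
  -- The solution `p` sought is `u ↦ q u 1`, where `q u` solves the equation along the ray through
  -- `u`. The bound on `u` sits inside the existential so that `choose` yields a total function.
  have hsol : ∀ u : F, ∃ α : ℝ → E, ‖u‖ ≤ r → α 0 = x₀ ∧ ∀ t ∈ Icc (0 : ℝ) 1,
      α t ∈ closedBall x₀ (a / 2) ∧ HasDerivWithinAt α (S (α t) u) (Icc 0 1) t := by
    intro u
    by_cases hu : ‖u‖ ≤ r
    · obtain ⟨α, h⟩ := exists_solution_mem_closedBall (f := fun q ↦ S q u) (half_pos ha).le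
        ((hlip u hu).mono hsub) (fun q hq ↦ by
          calc ‖S q u‖ ≤ ‖S q‖ * ‖u‖ := ContinuousLinearMap.le_opNorm _ _
            _ ≤ L * r := by
              gcongr
              exact hLB q (hsub hq)
            _ ≤ a / 2 := by linarith)
      exact ⟨α, fun _ ↦ h⟩
    · exact ⟨0, fun h ↦ absurd h hu⟩
  choose q hq using hsol
  -- The `+ 1` keeps `κ` nonzero, which the closed form of the Grönwall bound requires.
  set κ : ℝ≥0 := (K + 1) * r.toNNReal with hκdef
  have hκ : (κ : ℝ) ≠ 0 := by
    rw [hκdef]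
    rw [NNReal.coe_mul, Real.coe_toNNReal _ hr.le]
    push_cast
    have : (0 : ℝ) < K + 1 := by positivity
    exact (mul_pos this hr).ne'
  set c : ℝ := D * L + C * L * L * r with hcdef
  have key : ∀ u h : F, ‖u‖ ≤ r → ‖h‖ ≤ r → ‖u + h‖ ≤ r →
      ‖q (u + h) 1 - q u 1 - S (q u 1) h‖ ≤ c / κ * (Real.exp κ - 1) * ‖h‖ ^ 2 := by
    intro u h hu hh huh
    obtain ⟨hu0, hu1⟩ := hq u hu
    obtain ⟨hv0, hv1⟩ := hq (u + h) huh
    -- If `p` solves the equation, then `q u t = p (t u)` and the first-order change of this in `h`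
    -- is `t S(q u t) h`. So `z` should follow the trajectory of `u + h` up to `O(‖h‖²)`; Grönwall
    -- turns such a bound on the defect of `z` into one at time 1.
    set z : ℝ → E := fun t ↦ q u t + t • S (q u t) h with hzdef
    have hderivS : ∀ t ∈ Icc (0 : ℝ) 1, HasDerivWithinAt (fun t ↦ S (q u t) h)
        (fderiv ℝ S (q u t) (S (q u t) u) h) (Icc 0 1) t := by
      intro t ht
      have h1 := (hdiff _ (hsub (hu1 t ht).1)).hasFDerivAt.comp_hasDerivWithinAt t (hu1 t ht).2
      exact (ContinuousLinearMap.apply ℝ E h).hasFDerivAt.comp_hasDerivWithinAt t h1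
    have hz' : ∀ t ∈ Icc (0 : ℝ) 1, HasDerivWithinAt z
        (S (q u t) u + (t • fderiv ℝ S (q u t) (S (q u t) u) h + S (q u t) h)) (Icc 0 1) t := by
      intro t ht
      have := (hu1 t ht).2.fun_add ((hasDerivWithinAt_id t (Icc 0 1)).fun_smul (hderivS t ht))
      simpa using this
    have hzB : ∀ t ∈ Icc (0 : ℝ) 1, z t ∈ B := by
      intro t ht
      have h1 := (hu1 t ht).1
      rw [mem_closedBall_iff_norm] at h1 ⊢
      have h2 : ‖t • S (q u t) h‖ ≤ a / 4 := by
        rw [norm_smul, Real.norm_of_nonneg ht.1]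
        calc t * ‖S (q u t) h‖ ≤ 1 * (‖S (q u t)‖ * ‖h‖) := by
              gcongr
              · exact ht.2
              · exact ContinuousLinearMap.le_opNorm _ _
          _ ≤ 1 * (L * r) := by
              gcongr
              exact hLB _ (hsub (hu1 t ht).1)
          _ = a / 4 := by rw [one_mul, hLr]
      calc ‖z t - x₀‖ = ‖(q u t - x₀) + t • S (q u t) h‖ := by rw [hzdef]; congr 1; module
        _ ≤ _ := norm_add_le _ _
        _ ≤ a := by linarith
    have herr : ∀ t ∈ Icc (0 : ℝ) 1,
        dist (S (q u t) u + (t • fderiv ℝ S (q u t) (S (q u t) u) h + S (q u t) h))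
          (S (z t) (u + h)) ≤ c * ‖h‖ ^ 2 := by
      intro t ht
      have hqB := hsub (hu1 t ht).1
      have hSh : ‖S (q u t) h‖ ≤ L * ‖h‖ :=
        (ContinuousLinearMap.le_opNorm _ _).trans (by gcongr; exact hLB _ hqB)
      set R := S (z t) - S (q u t) - fderiv ℝ S (q u t) (z t - q u t) with hR
      have hzq : z t - q u t = t • S (q u t) h := by simp [hzdef]
      have hzqn : ‖z t - q u t‖ ≤ L * ‖h‖ := by
        rw [hzq, norm_smul, Real.norm_of_nonneg ht.1]
        calc t * ‖S (q u t) h‖ ≤ 1 * (L * ‖h‖) := by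
              gcongr
              exact ht.2
          _ = _ := one_mul _
      have hRn : ‖R‖ ≤ C * (L * ‖h‖) * (L * ‖h‖) := by
        refine (norm_sub_sub_fderiv_le (convex_closedBall x₀ a) hdiff hCB hqB (hzB t ht)).trans ?_
        gcongr
      have hSz : S (z t) = S (q u t) + t • fderiv ℝ S (q u t) (S (q u t) h) + R := by
        rw [hR, hzq, map_smul]; abel
      -- Integrability cancels the only defect term that is linear in `h`; what remains is
      -- quadratic.
      have hid : S (q u t) u + (t • fderiv ℝ S (q u t) (S (q u t) u) h + S (q u t) h)
          - S (z t) (u + h) = -(t • fderiv ℝ S (q u t) (S (q u t) h) h + R (u + h)) := by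
        rw [hSz, hsymm (q u t) (hΩB hqB) h u]
        simp only [add_apply, smul_apply, map_add]
        abel
      rw [dist_eq_norm, hid, norm_neg]
      have h1 : ‖t • fderiv ℝ S (q u t) (S (q u t) h) h‖ ≤ D * (L * ‖h‖) * ‖h‖ := by
        rw [norm_smul, Real.norm_of_nonneg ht.1]
        calc t * ‖fderiv ℝ S (q u t) (S (q u t) h) h‖
            ≤ 1 * (‖fderiv ℝ S (q u t)‖ * ‖S (q u t) h‖ * ‖h‖) := by
              gcongr
              · exact ht.2
              · exact ContinuousLinearMap.le_opNorm₂ _ _ _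
          _ ≤ 1 * (D * (L * ‖h‖) * ‖h‖) := by
              gcongr
              exact hDB _ hqB
          _ = _ := one_mul _
      have h2 : ‖R (u + h)‖ ≤ C * (L * ‖h‖) * (L * ‖h‖) * r :=
        (ContinuousLinearMap.le_opNorm _ _).trans (by gcongr)
      calc _ ≤ _ := norm_add_le _ _
        _ ≤ D * (L * ‖h‖) * ‖h‖ + C * (L * ‖h‖) * (L * ‖h‖) * r := add_le_add h1 h2
        _ = c * ‖h‖ ^ 2 := by rw [hcdef]; ring
    have hIci : ∀ {f : ℝ → E} {f' : E} {t : ℝ}, t ∈ Ico (0 : ℝ) 1 →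
        HasDerivWithinAt f f' (Icc 0 1) t → HasDerivWithinAt f f' (Ici t) t := by
      intro f f' t ht hf
      refine hf.mono_of_mem_nhdsWithin ?_
      exact mem_of_superset (Icc_mem_nhdsGE ht.2) (Icc_subset_Icc_left ht.1)
    have hG := dist_le_of_approx_trajectories_ODE_of_mem (a := 0) (b := 1)
      (v := fun _ q ↦ S q (u + h)) (s := fun _ ↦ B) (K := κ) (δ := 0) (εf := 0)
      (εg := c * ‖h‖ ^ 2) (f := q (u + h)) (g := z)
      (fun _ _ ↦ hlip _ huh) (fun t ht ↦ (hv1 t ht).2.continuousWithinAt)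
      (fun t ht ↦ hIci ht (hv1 t (Ico_subset_Icc_self ht)).2) (fun _ _ ↦ (dist_self _).le)
      (fun t ht ↦ hsub (hv1 t (Ico_subset_Icc_self ht)).1)
      (fun t ht ↦ (hz' t ht).continuousWithinAt)
      (fun t ht ↦ hIci ht (hz' t (Ico_subset_Icc_self ht)))
      (fun t ht ↦ herr t (Ico_subset_Icc_self ht))
      (fun t ht ↦ hzB t (Ico_subset_Icc_self ht)) (by simp [hzdef, hu0, hv0])
      1 (by simp)
    rw [gronwallBound_of_K_ne_0 hκ, dist_eq_norm] at hG
    calc ‖q (u + h) 1 - q u 1 - S (q u 1) h‖ = ‖q (u + h) 1 - z 1‖ := by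
          simp [hzdef, sub_sub]
      _ ≤ _ := hG
      _ = _ := by simp only [zero_mul, zero_add, sub_zero, mul_one]; ring
  refine ⟨r, hr, fun u ↦ q u 1, ?_, fun u hu ↦ ⟨?_, ?_⟩⟩
  · have hconst : ∀ t ∈ Icc (0 : ℝ) 1, q 0 t = q 0 0 := by
      obtain ⟨h0, h1⟩ := hq 0 (by simpa using hr.le)
      refine constant_of_derivWithin_zero (fun t ht ↦ (h1 t ht).2.differentiableWithinAt)
        fun t ht ↦ ?_
      have := (h1 t (Ico_subset_Icc_self ht)).2.derivWithin
        (uniqueDiffOn_Icc zero_lt_one t (Ico_subset_Icc_self ht))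
      simpa using this
    simp only
    rw [hconst 1 (by simp), (hq 0 (by simpa using hr.le)).1]
  · rw [mem_ball_zero_iff] at hu
    exact hΩB (hsub ((hq u hu.le).2 1 (by simp)).1)
  · rw [mem_ball_zero_iff] at hu
    rw [hasFDerivAt_iff_isLittleO_nhds_zero]
    refine Asymptotics.IsBigO.trans_isLittleO (g := fun h : F ↦ ‖h‖ ^ 2) ?_ ?_
    · refine Asymptotics.IsBigO.of_bound (c / κ * (Real.exp κ - 1)) ?_
      have h1 : ∀ᶠ h : F in 𝓝 0, ‖h‖ < r := by
        filter_upwards [ball_mem_nhds (0 : F) hr] with h hh using mem_ball_zero_iff.1 hh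
      have h2 : ∀ᶠ h : F in 𝓝 0, ‖u + h‖ < r := by
        have : ContinuousAt (fun h : F ↦ ‖u + h‖) 0 := by fun_prop
        exact this.eventually_lt_const (by simpa using hu)
      filter_upwards [h1, h2] with h hh huh
      rw [norm_pow, norm_norm]
      exact key u h hu.le hh.le huh.le
    · exact Asymptotics.isLittleO_norm_pow_id one_lt_two

end TotalDifferentialEquation

/-! ### Alternating 2-forms as skew bilinear forms. -/

section Bilinear

variable {V : Type*} [NormedAddCommGroup V] [NormedSpace ℝ V]

theorem update_pair_one {α : Type*} (u a b : α) : Function.update ![u, a] 1 b = ![u, b] := by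
  ext i
  fin_cases i <;> simp

/-- The bilinear form `(u, v) ↦ η(u, v)` underlying an alternating 2-form `η`. -/
def bilin (η : V [⋀^Fin 2]→L[ℝ] ℝ) : V →L[ℝ] V →L[ℝ] ℝ :=
  LinearMap.mkContinuous₂ (LinearMap.mk₂ ℝ (fun u v ↦ η ![u, v])
    (fun a b v ↦ η.toMultilinearMap.cons_add ![v] a b)
    (fun c a v ↦ η.toMultilinearMap.cons_smul ![v] c a)
    (fun u a b ↦ by
      have := η.toMultilinearMap.map_update_add ![u, a] 1 a b
      rwa [update_pair_one, update_pair_one, update_pair_one] at this)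
    (fun c u a ↦ by
      have := η.toMultilinearMap.map_update_smul ![u, a] 1 c a
      rwa [update_pair_one, update_pair_one] at this)) ‖η‖ fun u v ↦ by
      have := η.le_opNorm ![u, v]
      change |η ![u, v]| ≤ _
      simpa [Fin.prod_univ_two, mul_assoc] using this

@[simp]
theorem bilin_apply (η : V [⋀^Fin 2]→L[ℝ] ℝ) (u v : V) : bilin η u v = η ![u, v] := rfl

theorem bilin_self (η : V [⋀^Fin 2]→L[ℝ] ℝ) (u : V) : bilin η u u = 0 :=
  η.map_eq_zero_of_eq ![u, u] (i := 0) (j := 1) rfl (by decide)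

theorem bilin_swap (η : V [⋀^Fin 2]→L[ℝ] ℝ) (u v : V) : bilin η u v = -bilin η v u := by
  have h := bilin_self η (u + v)
  simp only [map_add, add_apply, bilin_self] at h
  linarith

theorem contDiffOn_bilin [FiniteDimensional ℝ V] {W : Type*} [NormedAddCommGroup W]
    [NormedSpace ℝ W] {η : W → V [⋀^Fin 2]→L[ℝ] ℝ} {Ω : Set W} (hη : ContDiffOn ℝ ∞ η Ω) :
    ContDiffOn ℝ ∞ (fun q ↦ bilin (η q)) Ω := by
  refine contDiffOn_clm_apply.2 fun u ↦ contDiffOn_clm_apply.2 fun v ↦ ?_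
  exact (ContinuousAlternatingMap.apply ℝ V ℝ ![u, v]).contDiff.comp_contDiffOn hη

theorem fderiv_bilin_apply [FiniteDimensional ℝ V] {W : Type*} [NormedAddCommGroup W]
    [NormedSpace ℝ W] {η : W → V [⋀^Fin 2]→L[ℝ] ℝ} {Ω : Set W} (hΩ : IsOpen Ω)
    (hη : ContDiffOn ℝ ∞ η Ω) {q : W} (hq : q ∈ Ω) (a : W) (b c : V) :
    fderiv ℝ (fun q ↦ bilin (η q)) q a b c = fderiv ℝ η q a ![b, c] := by
  have h1 : DifferentiableAt ℝ (fun q ↦ bilin (η q)) q :=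
    ((contDiffOn_bilin hη).contDiffAt (hΩ.mem_nhds hq)).differentiableAt (by simp)
  have h2 : DifferentiableAt ℝ η q := (hη.contDiffAt (hΩ.mem_nhds hq)).differentiableAt (by simp)
  have e1 := (h1.hasFDerivAt.clm_apply (hasFDerivAt_const b q)).clm_apply (hasFDerivAt_const c q)
  have e2 := (ContinuousAlternatingMap.apply ℝ V ℝ ![b, c]).hasFDerivAt.comp q h2.hasFDerivAt
  have := congrArg (fun A : W →L[ℝ] ℝ ↦ A a) (e1.unique e2)
  simpa using this

/-- This is `dη(a, b, c) = 0` with the alternating sum written out; closedness enters the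
integrability proof in this form. -/
theorem fderiv_bilin_cyclic_sum [FiniteDimensional ℝ V] {η : V → V [⋀^Fin 2]→L[ℝ] ℝ} {Ω : Set V}
    (hΩ : IsOpen Ω) (hη : ContDiffOn ℝ ∞ η Ω) {q : V} (hq : q ∈ Ω) (hcl : extDeriv η q = 0)
    (a b c : V) :
    fderiv ℝ (fun q ↦ bilin (η q)) q a b c - fderiv ℝ (fun q ↦ bilin (η q)) q b a c +
      fderiv ℝ (fun q ↦ bilin (η q)) q c a b = 0 := by
  simp only [fderiv_bilin_apply hΩ hη hq]
  have h := congrArg (fun θ : V [⋀^Fin 3]→L[ℝ] ℝ ↦ θ ![a, b, c]) hcl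
  simp only [extDeriv, ContinuousAlternatingMap.alternatizeUncurryFin_apply] at h
  replace h : ∑ i : Fin 3, (-1 : ℤ) ^ (i : ℕ) • (fderiv ℝ η q (![a, b, c] i))
      (i.removeNth ![a, b, c]) = 0 := h
  rw [Fin.sum_univ_three] at h
  have r0 : Fin.removeNth (0 : Fin 3) ![a, b, c] = ![b, c] := by
    ext i; fin_cases i <;> rfl
  have r1 : Fin.removeNth (1 : Fin 3) ![a, b, c] = ![a, c] := by
    ext i; fin_cases i <;> rfl
  have r2 : Fin.removeNth (2 : Fin 3) ![a, b, c] = ![a, b] := by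
    ext i; fin_cases i <;> rfl
  rw [r0, r1, r2] at h
  simpa [← sub_eq_add_neg] using h

/-- A functional is of the form `B(X, ·)` for an alternating form `B` iff it vanishes on the
kernel of `B`. -/
theorem exists_eq_iff_forall_ker [FiniteDimensional ℝ V] {B : V →L[ℝ] V →L[ℝ] ℝ}
    (hB : ∀ u v, B u v = -B v u) (φ : V →L[ℝ] ℝ) :
    (∃ X, B X = φ) ↔ ∀ u, B u = 0 → φ u = 0 := by
  constructor
  · rintro ⟨X, rfl⟩ u hu
    rw [hB, hu]
    simp
  · intro h
    set f : V →ₗ[ℝ] Module.Dual ℝ V := LinearMap.mk₂ ℝ (fun u v ↦ B u v) (by simp) (by simp)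
      (by simp) (by simp) with hf
    have hφ : (φ : V →ₗ[ℝ] ℝ) ∈ LinearMap.range f.dualMap := by
      rw [LinearMap.range_dualMap_eq_dualAnnihilator_ker, Submodule.mem_dualAnnihilator]
      intro u hu
      refine h u ?_
      ext v
      exact LinearMap.congr_fun (LinearMap.mem_ker.1 hu) v
    obtain ⟨ψ, hψ⟩ := hφ
    obtain ⟨X, rfl⟩ := (Module.evalEquiv ℝ V).surjective ψ
    -- The dual map puts `X` in the second slot of `B`; moving it to the first costs a sign.
    refine ⟨-X, ?_⟩
    ext v
    have := LinearMap.congr_fun hψ v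
    rw [map_neg, neg_apply, ← hB v X]
    exact this

end Bilinear

/-! ### Smooth frames of a constant-rank kernel, and integrability. -/

section KernelFrame

open Topology

variable {V : Type*} [NormedAddCommGroup V] [NormedSpace ℝ V]
  {K : Type*} [NormedAddCommGroup K] [InnerProductSpace ℝ K]

/-- A smooth frame of the kernel of a smooth family `B` of bilinear forms on the open set `Ω`,
given as a smooth family of injective linear maps `S q` with image `ker (B q)`, normalised by
a projection `π`. -/
structure IsKernelFrame (B : V → V →L[ℝ] V →L[ℝ] ℝ) (S : V → K →L[ℝ] V) (π : V →L[ℝ] K)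
    (Ω : Set V) : Prop where
  isOpen : IsOpen Ω
  smooth : ContDiffOn ℝ ∞ S Ω
  apply_eq_zero : ∀ q ∈ Ω, ∀ u, B q (S q u) = 0
  apply_proj : ∀ q ∈ Ω, ∀ v, B q v = 0 → S q (π v) = v
  proj_apply : ∀ q ∈ Ω, ∀ u, π (S q u) = u

/-- Add to `B q` the form `⟨π ·, π ·⟩`, where `π` projects onto the kernel at `x₀`. The sum `P` is
invertible at `x₀`, since pairing `P u` with `u` leaves only `‖π u‖²`; hence it is invertible
nearby. On the kernel of `B q` one has `P q v = J (π v)`, which makes `(P q)⁻¹ ∘ J` the frame. -/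
theorem exists_isKernelFrame [FiniteDimensional ℝ V] [FiniteDimensional ℝ K]
    {B : V → V →L[ℝ] V →L[ℝ] ℝ} {Ω : Set V} (hΩ : IsOpen Ω)
    (hB : ContDiffOn ℝ ∞ B Ω) (halt : ∀ q u, B q u u = 0)
    (hrank : ∀ q ∈ Ω, Module.finrank ℝ (LinearMap.ker (B q).toLinearMap) = Module.finrank ℝ K)
    {x₀ : V} (hx₀ : x₀ ∈ Ω) :
    ∃ (S : V → K →L[ℝ] V) (π : V →L[ℝ] K) (Ω' : Set V), Ω' ⊆ Ω ∧ x₀ ∈ Ω' ∧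
      IsKernelFrame B S π Ω' := by
  obtain ⟨C, hC⟩ := Submodule.exists_isCompl (LinearMap.ker (B x₀).toLinearMap)
  let k : LinearMap.ker (B x₀).toLinearMap ≃ₗ[ℝ] K := LinearEquiv.ofFinrankEq _ _ (hrank x₀ hx₀)
  let π : V →L[ℝ] K := LinearMap.toContinuousLinearMap
    (k.toLinearMap ∘ₗ Submodule.projectionOnto _ C hC)
  have hπ : ∀ u, B x₀ u = 0 → π u = 0 → u = 0 := by
    intro u hu hu'
    have h1 : Submodule.projectionOnto _ C hC u = 0 := by
      have : k (Submodule.projectionOnto _ C hC u) = 0 := hu'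
      simpa using this
    rw [Submodule.projectionOnto_apply_eq_zero_iff] at h1
    exact Submodule.disjoint_def.1 hC.disjoint u (LinearMap.mem_ker.2 hu) h1
  let J : K →L[ℝ] V →L[ℝ] ℝ := ((ContinuousLinearMap.compL ℝ V K ℝ).flip π).comp (innerSL ℝ)
  have hJ : ∀ κ v, J κ v = inner ℝ κ (π v) := fun κ v ↦ rfl
  let P : V → V →L[ℝ] V →L[ℝ] ℝ := fun q ↦ B q + J.comp π
  have hP : ContDiffOn ℝ ∞ P Ω := hB.add contDiffOn_const
  have hPinj : Function.Injective (P x₀) := by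
    rw [injective_iff_map_eq_zero]
    intro u hu
    have h1 : π u = 0 := by
      have := congrArg (fun φ : V →L[ℝ] ℝ ↦ φ u) hu
      simpa [P, halt, hJ] using this
    refine hπ u ?_ h1
    simpa [P, h1] using hu
  have hdim : Module.finrank ℝ V = Module.finrank ℝ (V →L[ℝ] ℝ) := by
    rw [← (LinearMap.toContinuousLinearMap (𝕜 := ℝ) (E := V) (F' := ℝ)).finrank_eq]
    exact (Subspace.dual_finrank_eq (K := ℝ) (V := V)).symm
  let e₀ : V ≃L[ℝ] (V →L[ℝ] ℝ) :=
    (LinearEquiv.ofInjectiveOfFinrankEq (P x₀).toLinearMap hPinj hdim).toContinuousLinearEquiv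
  have he₀ : (e₀ : V →L[ℝ] (V →L[ℝ] ℝ)) = P x₀ := by
    ext u v; rfl
  set Ω' : Set V := Ω ∩ P ⁻¹' (range ((↑) : (V ≃L[ℝ] (V →L[ℝ] ℝ)) → (V →L[ℝ] (V →L[ℝ] ℝ))))
    with hΩ'
  refine ⟨fun q ↦ (P q).inverse.comp J, π, Ω', inter_subset_left, ⟨hx₀, e₀, he₀⟩, ?_⟩
  have hrange : ∀ q ∈ Ω', ∀ v, B q v = 0 → (P q).inverse (J (π v)) = v := by
    rintro q ⟨-, e, he⟩ v hv
    have : P q v = J (π v) := by simp [P, hv]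
    rw [← this, ← he, ContinuousLinearMap.inverse_equiv]
    exact e.symm_apply_apply v
  -- The kernel lies in the image of the frame, and constant rank forces equality by dimension.
  have hker : ∀ q ∈ Ω', ∀ u, B q ((P q).inverse (J u)) = 0 := by
    intro q hq u
    have h1 : LinearMap.ker (B q).toLinearMap ≤
        LinearMap.range ((P q).inverse.comp J).toLinearMap := fun v hv ↦
      ⟨π v, hrange q hq v hv⟩
    have h2 := Submodule.eq_of_le_of_finrank_le h1 (by
      rw [hrank q hq.1]
      exact LinearMap.finrank_range_le _)
    have h3 : (P q).inverse (J u) ∈ LinearMap.ker (B q).toLinearMap := h2 ▸ ⟨u, rfl⟩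
    exact h3
  refine ⟨hP.continuousOn.isOpen_inter_preimage hΩ (ContinuousLinearEquiv.isOpen), ?_, hker,
    hrange, fun q hq ↦ ?_⟩
  · intro q hq
    obtain ⟨hqΩ, e, he⟩ := hq
    have h1 : ContDiffAt ℝ ∞ (fun q ↦ (P q).inverse) q := by
      refine ContDiffAt.comp (g := ContinuousLinearMap.inverse) q ?_
        (hP.contDiffAt (hΩ.mem_nhds hqΩ))
      rw [← he]
      exact contDiffAt_map_inverse e
    exact (h1.clm_comp contDiffAt_const).contDiffWithinAt
  · have hsurj : Function.Surjective (π.toLinearMap ∘ₗ ((P q).inverse.comp J).toLinearMap) := by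
      rw [← LinearMap.injective_iff_surjective, injective_iff_map_eq_zero]
      intro u hu
      have h1 := hrange q hq _ (hker q hq u)
      have hu' : π ((P q).inverse (J u)) = 0 := hu
      rw [hu', map_zero, map_zero] at h1
      obtain ⟨-, e, he⟩ := hq
      rw [← he, ContinuousLinearMap.inverse_equiv] at h1
      have h2 : J u = 0 := e.symm.injective (h1.symm.trans (map_zero e.symm).symm)
      have hsurjπ : Function.Surjective π := by
        intro κ
        obtain ⟨n, rfl⟩ := k.surjective κ
        refine ⟨n, ?_⟩
        simp [π]
      obtain ⟨v, rfl⟩ := hsurjπ u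
      have h3 := congrArg (fun φ : V →L[ℝ] ℝ ↦ φ v) h2
      simpa [hJ] using h3
    intro u
    obtain ⟨w, hw⟩ := hsurj u
    have hw' : π ((P q).inverse (J w)) = u := hw
    have h1 := hrange q hq _ (hker q hq w)
    rw [hw'] at h1
    change π ((P q).inverse (J u)) = u
    rw [h1, hw']

namespace IsKernelFrame

variable {B : V → V →L[ℝ] V →L[ℝ] ℝ} {S : V → K →L[ℝ] V} {π : V →L[ℝ] K} {Ω : Set V}

theorem injective (hS : IsKernelFrame B S π Ω) {q : V} (hq : q ∈ Ω) :
    Function.Injective (S q) := fun u v h ↦ by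
  rw [← hS.proj_apply q hq u, h, hS.proj_apply q hq]

/-- The kernel of a closed 2-form is integrable. -/
theorem fderiv_apply_symm [FiniteDimensional ℝ V] {Ω₀ : Set V} {η : V → V [⋀^Fin 2]→L[ℝ] ℝ}
    (hS : IsKernelFrame (fun q ↦ bilin (η q)) S π Ω) (hΩ₀ : IsOpen Ω₀) (hsub : Ω ⊆ Ω₀)
    (hη : ContDiffOn ℝ ∞ η Ω₀) (hcl : ∀ q ∈ Ω₀, extDeriv η q = 0) {q : V} (hq : q ∈ Ω) (u v : K) :
    fderiv ℝ S q (S q v) u = fderiv ℝ S q (S q u) v := by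
  have hSd : DifferentiableAt ℝ S q :=
    (hS.smooth.contDiffAt (hS.isOpen.mem_nhds hq)).differentiableAt (by simp)
  have hBd : DifferentiableAt ℝ (fun q ↦ bilin (η q)) q :=
    ((contDiffOn_bilin hη).contDiffAt (hΩ₀.mem_nhds (hsub hq))).differentiableAt (by simp)
  have hSu : ∀ κ, HasFDerivAt (fun q ↦ S q κ) ((fderiv ℝ S q).flip κ) q := fun κ ↦
    (ContinuousLinearMap.apply ℝ V κ).hasFDerivAt.comp q hSd.hasFDerivAt
  -- Differentiate the identity `B(q)(S(q) κ) = 0`.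
  have hdiff : ∀ κ d c, fderiv ℝ (fun q ↦ bilin (η q)) q d (S q κ) c =
      -bilin (η q) (fderiv ℝ S q d κ) c := by
    intro κ d c
    have h1 := (hBd.hasFDerivAt.clm_apply (hSu κ))
    have h2 : HasFDerivAt (fun q ↦ bilin (η q) (S q κ)) (0 : V →L[ℝ] V →L[ℝ] ℝ) q := by
      refine (hasFDerivAt_const (0 : V →L[ℝ] ℝ) q).congr_of_eventuallyEq ?_
      filter_upwards [hS.isOpen.mem_nhds hq] with q' hq' using hS.apply_eq_zero q' hq' κ
    have h3 := congrArg (fun A : V →L[ℝ] V →L[ℝ] ℝ ↦ A d c) (h1.unique h2)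
    simp only [add_apply, ContinuousLinearMap.comp_apply, ContinuousLinearMap.flip_apply,
      zero_apply] at h3
    linarith
  -- The map `q ↦ π (S q κ)` is constant, so derivatives of the frame have no `π` component. A
  -- kernel vector with this property is zero.
  have hπ : ∀ κ d, π (fderiv ℝ S q d κ) = 0 := by
    intro κ d
    have h1 := π.hasFDerivAt.comp q (hSu κ)
    have h2 : HasFDerivAt (fun q ↦ π (S q κ)) (0 : V →L[ℝ] K) q := by
      refine (hasFDerivAt_const κ q).congr_of_eventuallyEq ?_
      filter_upwards [hS.isOpen.mem_nhds hq] with q' hq' using hS.proj_apply q' hq' κ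
    exact congrArg (fun A : V →L[ℝ] K ↦ A d) (h1.unique h2)
  -- In the closedness identity for `S u`, `S v`, `w`, the term differentiated along `w` pairs with
  -- the kernel vector `S v` and drops out.
  have hk : bilin (η q) (fderiv ℝ S q (S q v) u - fderiv ℝ S q (S q u) v) = 0 := by
    ext w
    have h := fderiv_bilin_cyclic_sum hΩ₀ hη (hsub hq) (hcl q (hsub hq)) (S q u) (S q v) w
    rw [hdiff, hdiff, hdiff, bilin_swap (η q) _ (S q v), hS.apply_eq_zero q hq v] at h
    simp only [map_sub, sub_apply, zero_apply, neg_zero] at h ⊢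
    linarith
  have h := hS.apply_proj q hq _ hk
  rw [map_sub, hπ, hπ, sub_zero, map_zero] at h
  exact (sub_eq_zero.1 h.symm)

end IsKernelFrame

end KernelFrame

/-! ### Inverse function theorem with smooth inverse. -/

section InverseFunction

variable {V W : Type*} [NormedAddCommGroup V] [NormedSpace ℝ V] [FiniteDimensional ℝ V]
  [NormedAddCommGroup W] [NormedSpace ℝ W] [FiniteDimensional ℝ W]

/-- The inverse function theorem: a smooth map with bijective derivative at a point restricts to
a diffeomorphism between neighbourhoods. -/
theorem exists_openPartialHomeomorph_of_injective_fderiv {Ψ : V → W} {Ω : Set V} (hΩ : IsOpen Ω)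
    (hΨ : ContDiffOn ℝ ∞ Ψ Ω) {x₀ : V} (hx₀ : x₀ ∈ Ω)
    (hinj : Function.Injective (fderiv ℝ Ψ x₀))
    (hdim : Module.finrank ℝ V = Module.finrank ℝ W) :
    ∃ φ : OpenPartialHomeomorph V W, x₀ ∈ φ.source ∧ φ.source ⊆ Ω ∧ (φ : V → W) = Ψ ∧
      ContDiffOn ℝ ∞ φ φ.source ∧ ContDiffOn ℝ ∞ φ.symm φ.target := by
  have hΨx : ContDiffAt ℝ ∞ Ψ x₀ := hΨ.contDiffAt (hΩ.mem_nhds hx₀)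
  let e₀ : V ≃L[ℝ] W :=
    (LinearEquiv.ofInjectiveOfFinrankEq (fderiv ℝ Ψ x₀).toLinearMap hinj hdim).toContinuousLinearEquiv
  have he₀ : (e₀ : V →L[ℝ] W) = fderiv ℝ Ψ x₀ := by
    ext u; rfl
  have hd : HasFDerivAt Ψ (e₀ : V →L[ℝ] W) x₀ := by
    rw [he₀]
    exact (hΨx.differentiableAt (by simp)).hasFDerivAt
  -- Smoothness of the inverse at every point of the target needs an invertible derivative
  -- throughout the source; this is an open condition.
  set Ω' : Set V := Ω ∩ fderiv ℝ Ψ ⁻¹' (range ((↑) : (V ≃L[ℝ] W) → (V →L[ℝ] W))) with hΩ'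
  have hopen : IsOpen Ω' :=
    (hΨ.continuousOn_fderiv_of_isOpen hΩ (by simp)).isOpen_inter_preimage hΩ
      ContinuousLinearEquiv.isOpen
  set φ := (hΨx.toOpenPartialHomeomorph Ψ hd (by simp)).restrOpen Ω' hopen with hφ
  have hsrc : φ.source ⊆ Ω' := inter_subset_right
  refine ⟨φ, ⟨hΨx.mem_toOpenPartialHomeomorph_source hd (by simp), hx₀, e₀, he₀⟩,
    hsrc.trans inter_subset_left, rfl, hΨ.mono (hsrc.trans inter_subset_left), ?_⟩
  intro w hw
  have hv := φ.map_target hw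
  obtain ⟨hvΩ, e, he⟩ := hsrc hv
  have hat : ContDiffAt ℝ ∞ Ψ (φ.symm w) := hΨ.contDiffAt (hΩ.mem_nhds hvΩ)
  refine (φ.contDiffAt_symm (f₀' := e) hw ?_ hat).contDiffWithinAt
  rw [he]
  exact (hat.differentiableAt (by simp)).hasFDerivAt

end InverseFunction

theorem finrank_continuousLinearMap_real (V : Type*) [NormedAddCommGroup V] [NormedSpace ℝ V]
    [FiniteDimensional ℝ V] : Module.finrank ℝ (V →L[ℝ] ℝ) = Module.finrank ℝ V := by
  rw [← (LinearMap.toContinuousLinearMap (𝕜 := ℝ) (E := V) (F' := ℝ)).finrank_eq]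
  exact Subspace.dual_finrank_eq (K := ℝ) (V := V)

/-! ### Integral manifolds, leafwise Hessian and straightening. -/

namespace IsKernelFrame

open Metric

variable {V : Type*} [NormedAddCommGroup V] [NormedSpace ℝ V]
  {K : Type*} [NormedAddCommGroup K] [InnerProductSpace ℝ K]
  {B : V → V →L[ℝ] V →L[ℝ] ℝ} {S : V → K →L[ℝ] V} {π : V →L[ℝ] K} {Ω : Set V}

/-- An integrable kernel has an integral manifold through every point. -/
theorem exists_integralManifold [CompleteSpace V] (hS : IsKernelFrame B S π Ω)
    (hsymm : ∀ q ∈ Ω, ∀ u v, fderiv ℝ S q (S q v) u = fderiv ℝ S q (S q u) v)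
    {x₀ : V} (hx₀ : x₀ ∈ Ω) :
    ∃ r > 0, ∃ p : K → V, p 0 = x₀ ∧ (∀ u ∈ ball (0 : K) r, p u ∈ Ω) ∧
      (∀ u ∈ ball (0 : K) r, HasFDerivAt p (S (p u)) u) ∧ ContDiffOn ℝ ∞ p (ball 0 r) ∧
      InjOn p (ball 0 r) := by
  obtain ⟨r, hr, p, hp0, hp⟩ := exists_hasFDerivAt_comp hS.isOpen hS.smooth hsymm hx₀
  refine ⟨r, hr, p, hp0, fun u hu ↦ (hp u hu).1, fun u hu ↦ (hp u hu).2,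
    contDiffOn_of_hasFDerivAt_comp isOpen_ball hS.smooth (fun u hu ↦ (hp u hu).1)
      fun u hu ↦ (hp u hu).2, ?_⟩
  -- Injectivity of `p` comes from `π ∘ p` being a translation: its derivative is `π ∘ S = id`.
  have hd : ∀ u ∈ ball (0 : K) r, HasFDerivAt (fun u ↦ π (p u) - u) (0 : K →L[ℝ] K) u := by
    intro u hu
    have h1 := (π.hasFDerivAt.comp u (hp u hu).2).sub (hasFDerivAt_id u)
    have h2 : π.comp (S (p u)) = ContinuousLinearMap.id ℝ K :=
      ContinuousLinearMap.ext fun κ ↦ hS.proj_apply (p u) (hp u hu).1 κ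
    rw [h2, sub_self] at h1
    exact h1
  have hconst : ∀ u ∈ ball (0 : K) r, ∀ v ∈ ball (0 : K) r, π (p u) - u = π (p v) - v := by
    intro u hu v hv
    exact isOpen_ball.is_const_of_fderiv_eq_zero (convex_ball _ _).isPreconnected
      (fun w hw ↦ (hd w hw).differentiableAt.differentiableWithinAt)
      (fun w hw ↦ (hd w hw).fderiv) hu hv
  intro u hu v hv huv
  have := hconst u hu v hv
  rw [huv] at this
  exact sub_right_injective this

/-- The Hessian of `h` along an integral manifold, in terms of the derivative of the leafwise
differential `q ↦ dh(q) ∘ S(q)`. -/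
theorem fderiv_fderiv_comp (hS : IsKernelFrame B S π Ω) {h : V → ℝ}
    (hh : ContDiffOn ℝ ∞ h Ω) {r : ℝ} (hr : 0 < r) {p : K → V}
    (hpΩ : ∀ u ∈ ball (0 : K) r, p u ∈ Ω)
    (hp : ∀ u ∈ ball (0 : K) r, HasFDerivAt p (S (p u)) u) :
    fderiv ℝ (h ∘ p) 0 = (fderiv ℝ h (p 0)).comp (S (p 0)) ∧
    ∀ a b, fderiv ℝ (fderiv ℝ (h ∘ p)) 0 a b =
      fderiv ℝ (fun q ↦ (fderiv ℝ h q).comp (S q)) (p 0) (S (p 0) a) b := by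
  have hhd : ∀ q ∈ Ω, DifferentiableAt ℝ h q := fun q hq ↦
    (hh.contDiffAt (hS.isOpen.mem_nhds hq)).differentiableAt (by simp)
  have h1 : ∀ u ∈ ball (0 : K) r, fderiv ℝ (h ∘ p) u = (fderiv ℝ h (p u)).comp (S (p u)) :=
    fun u hu ↦ ((hhd _ (hpΩ u hu)).hasFDerivAt.comp u (hp u hu)).fderiv
  have h0 : (0 : K) ∈ ball (0 : K) r := mem_ball_self hr
  refine ⟨h1 0 h0, fun a b ↦ ?_⟩
  have hG : ContDiffOn ℝ ∞ (fun q ↦ (fderiv ℝ h q).comp (S q)) Ω :=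
    (hh.fderiv_of_isOpen hS.isOpen (by simp)).clm_comp hS.smooth
  have hGd := ((hG.contDiffAt (hS.isOpen.mem_nhds (hpΩ 0 h0))).differentiableAt
    (by simp)).hasFDerivAt.comp (0 : K) (hp 0 h0)
  have h2 := hGd.congr_of_eventuallyEq (f₁ := fderiv ℝ (h ∘ p)) (by
    filter_upwards [isOpen_ball.mem_nhds h0] with u hu using h1 u hu)
  rw [h2.fderiv]
  rfl

/-- Local coordinates whose last components describe the zero set of a map that is submersive along
the kernel. -/
theorem exists_straightening [FiniteDimensional ℝ V] [FiniteDimensional ℝ K]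
    (hS : IsKernelFrame B S π Ω) {G : V → K →L[ℝ] ℝ} (hG : ContDiffOn ℝ ∞ G Ω)
    {x₀ : V} (hx₀ : x₀ ∈ Ω) (hnd : ∀ a, (∀ b, fderiv ℝ G x₀ (S x₀ a) b = 0) → a = 0)
    (E' : Type*) [NormedAddCommGroup E'] [NormedSpace ℝ E'] [FiniteDimensional ℝ E']
    (hdim : Module.finrank ℝ V = Module.finrank ℝ E' + Module.finrank ℝ K) :
    ∃ φ : OpenPartialHomeomorph V (E' × K), x₀ ∈ φ.source ∧ φ.source ⊆ Ω ∧
      ContDiffOn ℝ ∞ φ φ.source ∧ ContDiffOn ℝ ∞ φ.symm φ.target ∧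
      ∀ q ∈ φ.source, (φ q).2 = 0 ↔ G q = 0 := by
  set N := LinearMap.range (S x₀).toLinearMap with hN
  have hNrank : Module.finrank ℝ N = Module.finrank ℝ K :=
    LinearMap.finrank_range_of_inj (hS.injective hx₀)
  let A₀ : (V ⧸ N) ≃ₗ[ℝ] E' := LinearEquiv.ofFinrankEq _ _ (by
    have := N.finrank_quotient_add_finrank
    omega)
  -- The kernel of `A` is the image of `S x₀`, exactly where `hnd` makes the derivative of `G`
  -- injective. So `A` and `G` together are local coordinates.
  let A : V →L[ℝ] E' := LinearMap.toContinuousLinearMap (A₀.toLinearMap ∘ₗ N.mkQ)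
  have hA : ∀ v, A v = 0 → v ∈ N := by
    intro v hv
    have h1 : A₀ (N.mkQ v) = 0 := hv
    simpa using h1
  let D : (K →L[ℝ] ℝ) ≃L[ℝ] K :=
    (LinearEquiv.ofFinrankEq _ _ (finrank_continuousLinearMap_real K)).toContinuousLinearEquiv
  have hGd : HasFDerivAt G (fderiv ℝ G x₀) x₀ :=
    ((hG.contDiffAt (hS.isOpen.mem_nhds hx₀)).differentiableAt (by simp)).hasFDerivAt
  have hΨd : HasFDerivAt (fun q ↦ (A q, D (G q)))
      (A.prod ((D : (K →L[ℝ] ℝ) →L[ℝ] K).comp (fderiv ℝ G x₀))) x₀ :=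
    A.hasFDerivAt.prodMk ((D : (K →L[ℝ] ℝ) →L[ℝ] K).hasFDerivAt.comp x₀ hGd)
  obtain ⟨φ, h1, h2, h3, h4, h5⟩ := exists_openPartialHomeomorph_of_injective_fderiv
    (Ψ := fun q ↦ (A q, D (G q))) hS.isOpen
    (A.contDiff.contDiffOn.prodMk (D.contDiff.comp_contDiffOn hG)) hx₀ (by
      rw [hΨd.fderiv, injective_iff_map_eq_zero]
      intro v hv
      obtain ⟨hv1, hv2⟩ := Prod.ext_iff.1 hv
      obtain ⟨a, rfl⟩ := hA v hv1
      have h6 : fderiv ℝ G x₀ (S x₀ a) = 0 := by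
        have : D (fderiv ℝ G x₀ (S x₀ a)) = 0 := hv2
        simpa using this
      have h7 := hnd a fun b ↦ by rw [h6]; rfl
      rw [h7]
      exact map_zero (S x₀)) (by rw [Module.finrank_prod, hdim])
  refine ⟨φ, h1, h2, h4, h5, fun q _ ↦ ?_⟩
  rw [h3]
  exact D.map_eq_zero_iff

end IsKernelFrame

/-! ### Embedded submanifolds from slice charts. -/

section Submanifold

variable {E E' F : Type*} [NormedAddCommGroup E] [NormedSpace ℝ E]
  [NormedAddCommGroup E'] [NormedSpace ℝ E'] [NormedAddCommGroup F] [NormedSpace ℝ F]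
  {M : Type*} [TopologicalSpace M] [ChartedSpace E M]

/-- `Φ` is a slice chart of the subset `s`: in the linear coordinates `L` on the model space,
`s` is given by the vanishing of the second component. -/
structure IsSliceChart (s : Set M) (Φ : OpenPartialHomeomorph M E) (L : (E' × F) ≃L[ℝ] E) :
    Prop where
  mem_maximalAtlas : Φ ∈ IsManifold.maximalAtlas 𝓘(ℝ, E) ∞ M
  mem_iff : ∀ y ∈ Φ.source, y ∈ s ↔ (L.symm (Φ y)).2 = 0

namespace IsSliceChart

variable {s : Set M} {Φ : OpenPartialHomeomorph M E} {L : (E' × F) ≃L[ℝ] E}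

theorem symm_mem (h : IsSliceChart s Φ L) {z : E'} (hz : L (z, 0) ∈ Φ.target) :
    Φ.symm (L (z, 0)) ∈ s := by
  rw [h.mem_iff _ (Φ.map_target hz), Φ.right_inv hz, L.symm_apply_apply]

theorem apply_fst (h : IsSliceChart s Φ L) {y : M} (hy : y ∈ Φ.source) (hys : y ∈ s) :
    L ((L.symm (Φ y)).1, 0) = Φ y := by
  have h1 := (h.mem_iff y hy).1 hys
  rw [← h1, Prod.mk.eta, L.apply_symm_apply]

open Classical in
/-- The chart of the subset `s` induced by a slice chart. The point `x` is used as a default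
value. -/
def chart (h : IsSliceChart s Φ L) (x : s) : OpenPartialHomeomorph s E' where
  toFun y := (L.symm (Φ y)).1
  invFun z := if hz : L (z, 0) ∈ Φ.target then ⟨Φ.symm (L (z, 0)), h.symm_mem hz⟩ else x
  source := Subtype.val ⁻¹' Φ.source
  target := (fun z : E' ↦ L (z, 0)) ⁻¹' Φ.target
  map_source' := fun y hy ↦ by
    change L ((L.symm (Φ y)).1, 0) ∈ Φ.target
    rw [h.apply_fst hy y.2]
    exact Φ.map_source hy
  map_target' := fun z hz ↦ by
    rw [dif_pos (by exact hz)]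
    exact Φ.map_target hz
  left_inv' := fun y hy ↦ by
    have h1 : L ((L.symm (Φ y)).1, 0) = Φ y := h.apply_fst hy y.2
    have h2 : L ((L.symm (Φ y)).1, 0) ∈ Φ.target := by
      rw [h1]
      exact Φ.map_source hy
    rw [dif_pos h2]
    ext
    simp only [h1]
    exact Φ.left_inv hy
  right_inv' := fun z hz ↦ by
    have hz' : L (z, 0) ∈ Φ.target := hz
    rw [dif_pos hz']
    simp [Φ.right_inv hz']
  open_source := Φ.open_source.preimage continuous_subtype_val
  open_target := Φ.open_target.preimage (by fun_prop)
  continuousOn_toFun := by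
    have h1 : ContinuousOn (fun y : s ↦ Φ y) (Subtype.val ⁻¹' Φ.source) :=
      Φ.continuousOn.comp continuous_subtype_val.continuousOn fun _ hy ↦ hy
    exact (continuous_fst.comp L.symm.continuous).comp_continuousOn h1
  continuousOn_invFun := by
    rw [Topology.IsInducing.subtypeVal.continuousOn_iff]
    have h1 : ContinuousOn (fun z : E' ↦ Φ.symm (L (z, 0)))
        ((fun z : E' ↦ L (z, 0)) ⁻¹' Φ.target) :=
      Φ.symm.continuousOn.comp (by fun_prop) fun _ hz ↦ hz
    refine h1.congr fun z hz ↦ ?_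
    have hz' : L (z, 0) ∈ Φ.target := hz
    simp [hz']

open Classical in
theorem coe_chart_symm (h : IsSliceChart s Φ L) (x : s) {z : E'} (hz : L (z, 0) ∈ Φ.target) :
    ((h.chart x).symm z : M) = Φ.symm (L (z, 0)) := by
  change ((if hz : L (z, 0) ∈ Φ.target then (⟨Φ.symm (L (z, 0)), h.symm_mem hz⟩ : s) else x : s) :
    M) = _
  rw [dif_pos hz]

end IsSliceChart

/-- A subset with slice charts around all its points is an embedded submanifold. -/
theorem exists_isSmoothEmbedding_of_sliceCharts {s : Set M}
    (hs : ∀ x : s, ∃ (Φ : OpenPartialHomeomorph M E) (L : (E' × F) ≃L[ℝ] E),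
      (x : M) ∈ Φ.source ∧ IsSliceChart s Φ L) :
    ∃ _ : ChartedSpace E' s, IsManifold 𝓘(ℝ, E') ∞ s ∧
      IsSmoothEmbedding 𝓘(ℝ, E') 𝓘(ℝ, E) ∞ (Subtype.val : s → M) := by
  choose Φ L hmem hΦ using hs
  let c : s → OpenPartialHomeomorph s E' := fun x ↦ (hΦ x).chart x
  let inst : ChartedSpace E' s :=
    { atlas := range c
      chartAt := c
      mem_chart_source := fun x ↦ hmem x
      chart_mem_atlas := fun x ↦ mem_range_self x }
  have hman : IsManifold 𝓘(ℝ, E') ∞ s := by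
    refine isManifold_of_contDiffOn _ _ _ ?_
    rintro _ _ ⟨x, rfl⟩ ⟨y, rfl⟩
    have hcompat := (contDiffGroupoid ∞ 𝓘(ℝ, E)).compatible_of_mem_maximalAtlas
      (hΦ x).mem_maximalAtlas (hΦ y).mem_maximalAtlas
    have hsm : ContDiffOn ℝ ∞ (Φ y ∘ (Φ x).symm) ((Φ x).symm ≫ₕ Φ y).source := by
      rw [contDiffGroupoid, mem_groupoid_of_pregroupoid] at hcompat
      simpa [contDiffPregroupoid] using hcompat.1
    have hmaps : ∀ z ∈ ((c x).symm ≫ₕ c y).source, L x (z, 0) ∈ (Φ x).target ∧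
        (Φ x).symm (L x (z, 0)) ∈ (Φ y).source := by
      intro z hz
      have h1 : L x (z, 0) ∈ (Φ x).target := hz.1
      have h2 : ((c x).symm z : M) ∈ (Φ y).source := hz.2
      rw [(hΦ x).coe_chart_symm x h1] at h2
      exact ⟨h1, h2⟩
    -- The transition map of `s` is that of `M`, restricted to the slice and followed by the first
    -- projection.
    have h1 : ContDiffOn ℝ ∞ (fun z ↦ ((L y).symm ((Φ y ∘ (Φ x).symm) (L x (z, 0)))).1)
        ((c x).symm ≫ₕ c y).source := by
      refine contDiff_fst.comp_contDiffOn ((L y).symm.contDiff.comp_contDiffOn ?_)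
      refine hsm.comp ?_ fun z hz ↦ hmaps z hz
      exact ((L x).contDiff.comp (contDiff_prodMk_left 0)).contDiffOn
    simp only [modelWithCornersSelf_coe, modelWithCornersSelf_coe_symm, Function.id_comp,
      Function.comp_id, range_id, inter_univ, preimage_id]
    refine h1.congr fun z hz ↦ ?_
    change ((L y).symm (Φ y ((c x).symm z))).1 = _
    rw [(hΦ x).coe_chart_symm x (hmaps z hz).1]
    rfl
  refine ⟨inst, hman, ?_, Topology.IsEmbedding.subtypeVal⟩
  refine IsImmersionOfComplement.isImmersion (F := F) fun x ↦ ?_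
  refine IsImmersionAtOfComplement.mk_of_charts (L x) (c x) (Φ x) (hmem x) (hmem x)
    ?_ (hΦ x).mem_maximalAtlas ?_ ?_
  · exact IsManifold.subset_maximalAtlas (mem_range_self x)
  · exact fun y hy ↦ hy
  · intro z hz
    have hz' : L x (z, 0) ∈ (Φ x).target := by
      rw [OpenPartialHomeomorph.extend_target] at hz
      exact hz.1
    have h1 := (hΦ x).coe_chart_symm x hz'
    simp only [OpenPartialHomeomorph.extend_coe, OpenPartialHomeomorph.extend_coe_symm,
      modelWithCornersSelf_coe, modelWithCornersSelf_coe_symm, Function.id_comp,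
      Function.comp_id, Function.comp_apply]
    change Φ x ((c x).symm z : M) = _
    rw [h1, (Φ x).right_inv hz']

end Submanifold

/-! ### Smooth dependence of 2-forms and their pullbacks on parameters. -/

section BilinSmooth

variable {V : Type*} [NormedAddCommGroup V] [NormedSpace ℝ V]

theorem bilin_injective : Function.Injective (bilin (V := V)) := by
  intro η θ h
  ext w
  have h1 := congrArg (fun B : V →L[ℝ] V →L[ℝ] ℝ ↦ B (w 0) (w 1)) h
  have h2 : w = ![w 0, w 1] := by
    ext i
    fin_cases i <;> rfl
  rw [h2]
  exact h1

/-- A family of 2-forms is smooth if the underlying family of bilinear forms is. -/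
theorem contDiffAt_of_bilin [FiniteDimensional ℝ V] {W : Type*} [NormedAddCommGroup W]
    [NormedSpace ℝ W] {η : W → V [⋀^Fin 2]→L[ℝ] ℝ} {q : W}
    (h : ContDiffAt ℝ ∞ (fun q ↦ bilin (η q)) q) : ContDiffAt ℝ ∞ η q := by
  let b : (V [⋀^Fin 2]→L[ℝ] ℝ) →ₗ[ℝ] V →L[ℝ] V →L[ℝ] ℝ :=
    { toFun := bilin
      map_add' := fun _ _ ↦ rfl
      map_smul' := fun _ _ ↦ rfl }
  have hb : Function.Injective b := bilin_injective
  -- A linear left inverse of `bilin`, continuous by finite dimension, carries smoothness back from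
  -- bilinear forms to 2-forms.
  obtain ⟨ψ, hψ⟩ := LinearMap.exists_leftInverse_of_injective (K := ℝ)
    (V := V [⋀^Fin 2]→L[ℝ] ℝ) (V' := V →L[ℝ] V →L[ℝ] ℝ) b 
    (LinearMap.ker_eq_bot'.2 fun θ hθ ↦ hb (hθ.trans (map_zero b).symm))
  have h1 := (LinearMap.toContinuousLinearMap ψ).contDiff.contDiffAt.comp q h
  refine h1.congr_of_eventuallyEq (Filter.Eventually.of_forall fun q' ↦ ?_)
  exact (LinearMap.congr_fun hψ (η q')).symm

theorem contDiffAt_compContinuousLinearMap {W X : Type*} [FiniteDimensional ℝ V]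
    [NormedAddCommGroup W] [NormedSpace ℝ W] [FiniteDimensional ℝ W]
    [NormedAddCommGroup X] [NormedSpace ℝ X] {η : X → V [⋀^Fin 2]→L[ℝ] ℝ} {A : X → W →L[ℝ] V}
    {q : X} (hη : ContDiffAt ℝ ∞ η q) (hA : ContDiffAt ℝ ∞ A q) :
    ContDiffAt ℝ ∞ (fun q ↦ (η q).compContinuousLinearMap (A q)) q := by
  have hb : ContDiffAt ℝ ∞ (fun q ↦ bilin (η q)) q := by
    rw [← contDiffWithinAt_univ] at hη ⊢
    have h1 : ContDiff ℝ ∞ (bilin (V := V)) := by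
      rw [← contDiffOn_univ]
      exact contDiffOn_bilin contDiffOn_id
    exact h1.contDiffAt.comp_contDiffWithinAt q hη
  refine contDiffAt_of_bilin ?_
  have h2 : (fun q ↦ bilin ((η q).compContinuousLinearMap (A q))) = fun q ↦
      ((ContinuousLinearMap.compL ℝ W V ℝ).flip (A q)).comp ((bilin (η q)).comp (A q)) := by
    ext q u v
    change η q _ = η q _
    congr 1
    ext i
    fin_cases i <;> rfl
  rw [h2]
  exact (((ContinuousLinearMap.compL ℝ W V ℝ).flip.contDiff.contDiffAt.comp q hA)).clm_comp
    (hb.clm_comp hA)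

end BilinSmooth

/-! ### Tangent-space notions over the fixed model space. -/

section Derivative

variable {W V X : Type*} [NormedAddCommGroup W] [NormedSpace ℝ W]
  [NormedAddCommGroup V] [NormedSpace ℝ V] [NormedAddCommGroup X] [NormedSpace ℝ X]
  {N P Q : Type*} [TopologicalSpace N] [ChartedSpace V N] [TopologicalSpace P] [ChartedSpace W P]
  [TopologicalSpace Q] [ChartedSpace X Q]

variable (W V) in
/-- The manifold derivative as a linear map between the model spaces. -/
def derivAt (f : P → N) (x : P) : W →L[ℝ] V := mfderiv 𝓘(ℝ, W) 𝓘(ℝ, V) f x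

/-- The value of a 2-form at a point, as an alternating map on the model space. -/
def formAt (η : TwoForm V N) (x : N) : V [⋀^Fin 2]→L[ℝ] ℝ := η x

/-- The kernel of a 2-form at a point, as a subspace of the model space. -/
def kerAt (η : TwoForm V N) (x : N) : Submodule ℝ V := η.ker x

theorem derivAt_comp {g : P → N} {f : Q → P} {x : Q}
    (hg : MDifferentiableAt 𝓘(ℝ, W) 𝓘(ℝ, V) g (f x))
    (hf : MDifferentiableAt 𝓘(ℝ, X) 𝓘(ℝ, W) f x) :
    derivAt X V (g ∘ f) x = (derivAt W V g (f x)).comp (derivAt X W f x) :=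
  mfderiv_comp x hg hf

theorem derivAt_congr {f g : P → N} {x : P} (h : f =ᶠ[nhds x] g) :
    derivAt W V f x = derivAt W V g x :=
  h.mfderiv_eq

theorem derivAt_eq_fderiv (f : W → V) (x : W) : derivAt W V f x = fderiv ℝ f x :=
  mfderiv_eq_fderiv

theorem mem_kerAt_iff {η : TwoForm V N} {x : N} {u : V} :
    u ∈ kerAt η x ↔ bilin (formAt η x) u = 0 := by
  constructor
  · intro h
    ext v
    exact h v
  · intro h v
    exact congrArg (fun φ : V →L[ℝ] ℝ ↦ φ v) h

theorem mem_hiddenConstraintSet_iff {η : TwoForm V N} {H : N → ℝ} {x : N} :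
    x ∈ hiddenConstraintSet η H ↔ ∃ X : V, bilin (formAt η x) X = derivAt V ℝ H x := by
  constructor
  · rintro ⟨X, hX⟩
    refine ⟨X, ?_⟩
    ext v
    exact hX v
  · rintro ⟨X, hX⟩
    exact ⟨X, fun v ↦ congrArg (fun φ : V →L[ℝ] ℝ ↦ φ v) hX⟩

theorem isHamiltonianCurveOn_iff {η : TwoForm V N} {H : N → ℝ} {γ : ℝ → N} {J : Set ℝ} :
    IsHamiltonianCurveOn η H γ J ↔ ∀ t ∈ J, MDifferentiableAt 𝓘(ℝ, ℝ) 𝓘(ℝ, V) γ t ∧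
      bilin (formAt η (γ t)) (derivAt ℝ V γ t 1) = derivAt V ℝ H (γ t) := by
  refine forall₂_congr fun t _ ↦ and_congr_right fun _ ↦ ?_
  constructor
  · intro h
    ext v
    exact h v
  · exact fun h v ↦ congrArg (fun φ : V →L[ℝ] ℝ ↦ φ v) h

theorem formAt_pullback (η : TwoForm V N) (f : P → N) (x : P) :
    formAt (η.pullback (W := W) f) x =
      (formAt η (f x)).compContinuousLinearMap (derivAt W V f x) := rfl

theorem bilin_compContinuousLinearMap (θ : V [⋀^Fin 2]→L[ℝ] ℝ) (A : W →L[ℝ] V) (u v : W) :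
    bilin (θ.compContinuousLinearMap A) u v = bilin θ (A u) (A v) := by
  change θ _ = θ _
  congr 1
  ext i
  fin_cases i <;> rfl

end Derivative

/-! ### Kernel, constraint and Hamiltonian equation in a chart. -/

section Charts

variable {V : Type*} [NormedAddCommGroup V] [NormedSpace ℝ V]
  {N : Type*} [TopologicalSpace N] [ChartedSpace V N]

theorem inChart_apply (η : TwoForm V N) (e : OpenPartialHomeomorph N V) {x : N}
    (hx : x ∈ e.source) : η.inChart e (e x) =
      (formAt η x).compContinuousLinearMap (derivAt V V e.symm (e x)) := by
  change (formAt η (e.symm (e x))).compContinuousLinearMap (derivAt V V e.symm (e x)) = _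
  rw [e.left_inv hx]

theorem bilin_inChart (η : TwoForm V N) (e : OpenPartialHomeomorph N V) {x : N}
    (hx : x ∈ e.source) (u v : V) : bilin (η.inChart e (e x)) u v =
      bilin (formAt η x) (derivAt V V e.symm (e x) u) (derivAt V V e.symm (e x) v) := by
  rw [inChart_apply η e hx, bilin_compContinuousLinearMap]

variable [IsManifold 𝓘(ℝ, V) ∞ N] {e : OpenPartialHomeomorph N V}

theorem mdifferentiable_chart_of_mem_atlas (he : e ∈ atlas V N) :
    e.MDifferentiable 𝓘(ℝ, V) 𝓘(ℝ, V) :=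
  have : IsManifold 𝓘(ℝ, V) 1 N := IsManifold.of_le (n := ∞) (by simp)
  mdifferentiable_of_mem_atlas he

theorem derivAt_chart_symm_bijective (he : e ∈ atlas V N) {y : V} (hy : y ∈ e.target) :
    Function.Bijective (derivAt V V e.symm y) :=
  (mdifferentiable_chart_of_mem_atlas he).symm.mfderiv_bijective hy

theorem derivAt_comp_chart_symm {W P : Type*} [NormedAddCommGroup W] [NormedSpace ℝ W]
    [TopologicalSpace P] [ChartedSpace W P] (he : e ∈ atlas V N) {f : N → P} {x : N}
    (hx : x ∈ e.source) (hf : MDifferentiableAt 𝓘(ℝ, V) 𝓘(ℝ, W) f x) :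
    derivAt V W (f ∘ e.symm) (e x) = (derivAt V W f x).comp (derivAt V V e.symm (e x)) := by
  have h := derivAt_comp (V := W) (W := V) (X := V) (g := f) (f := e.symm)
    (x := e x) (by rwa [e.left_inv hx])
    ((mdifferentiable_chart_of_mem_atlas he).mdifferentiableAt_symm (e.map_source hx))
  rwa [e.left_inv hx] at h

theorem fderiv_comp_chart_symm (he : e ∈ atlas V N) {H : N → ℝ} {x : N}
    (hx : x ∈ e.source) (hH : MDifferentiableAt 𝓘(ℝ, V) 𝓘(ℝ, ℝ) H x) :
    fderiv ℝ (H ∘ e.symm) (e x) = (derivAt V ℝ H x).comp (derivAt V V e.symm (e x)) := by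
  rw [← derivAt_eq_fderiv]
  exact derivAt_comp_chart_symm he hx hH

theorem derivAt_chart_symm_comp_derivAt {W P : Type*} [NormedAddCommGroup W] [NormedSpace ℝ W]
    [TopologicalSpace P] [ChartedSpace W P] (he : e ∈ atlas V N) {f : P → N} {x : P}
    (hx : f x ∈ e.source) (hf : MDifferentiableAt 𝓘(ℝ, W) 𝓘(ℝ, V) f x) :
    (derivAt V V e.symm (e (f x))).comp (derivAt W V (e ∘ f) x) = derivAt W V f x := by
  have hed := mdifferentiable_chart_of_mem_atlas he
  rw [derivAt_comp (hed.mdifferentiableAt hx) hf]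
  have h : (derivAt V V e.symm (e (f x))).comp (derivAt V V e (f x)) =
      ContinuousLinearMap.id ℝ V := hed.symm_comp_deriv hx
  rw [← ContinuousLinearMap.comp_assoc, h, ContinuousLinearMap.id_comp]

/-- The Hamiltonian equation at a point, in a chart. -/
theorem hamiltonian_iff_chart (η : TwoForm V N) (he : e ∈ atlas V N) {H : N → ℝ} {x : N}
    (hx : x ∈ e.source) (hH : MDifferentiableAt 𝓘(ℝ, V) 𝓘(ℝ, ℝ) H x) (w : V) :
    bilin (formAt η x) (derivAt V V e.symm (e x) w) = derivAt V ℝ H x ↔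
      bilin (η.inChart e (e x)) w = fderiv ℝ (H ∘ e.symm) (e x) := by
  rw [fderiv_comp_chart_symm he hx hH]
  constructor
  · intro h
    ext v
    rw [bilin_inChart η e hx, h]
    rfl
  · intro h
    ext v
    obtain ⟨v', rfl⟩ := (derivAt_chart_symm_bijective he (e.map_source hx)).2 v
    rw [← bilin_inChart η e hx, h]
    rfl

theorem mem_hiddenConstraintSet_iff_chart (η : TwoForm V N) (he : e ∈ atlas V N) {H : N → ℝ}
    {x : N} (hx : x ∈ e.source) (hH : MDifferentiableAt 𝓘(ℝ, V) 𝓘(ℝ, ℝ) H x) :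
    x ∈ hiddenConstraintSet η H ↔
      ∃ w, bilin (η.inChart e (e x)) w = fderiv ℝ (H ∘ e.symm) (e x) := by
  rw [mem_hiddenConstraintSet_iff]
  constructor
  · rintro ⟨X, hX⟩
    obtain ⟨w, rfl⟩ := (derivAt_chart_symm_bijective he (e.map_source hx)).2 X
    exact ⟨w, (hamiltonian_iff_chart η he hx hH w).1 hX⟩
  · rintro ⟨w, hw⟩
    exact ⟨_, (hamiltonian_iff_chart η he hx hH w).2 hw⟩

theorem derivAt_chart_symm_mem_kerAt_iff (η : TwoForm V N) (he : e ∈ atlas V N) {x : N}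
    (hx : x ∈ e.source) (u : V) :
    derivAt V V e.symm (e x) u ∈ kerAt η x ↔ bilin (η.inChart e (e x)) u = 0 := by
  rw [mem_kerAt_iff]
  constructor
  · intro h
    ext v
    rw [bilin_inChart η e hx, h]
    rfl
  · intro h
    ext v
    obtain ⟨v', rfl⟩ := (derivAt_chart_symm_bijective he (e.map_source hx)).2 v
    rw [← bilin_inChart η e hx, h]
    rfl

/-- The derivative of the inverse chart is an isomorphism between the two kernels; this carries the
constant-rank hypothesis into charts. -/
theorem finrank_ker_bilin_inChart (η : TwoForm V N) (he : e ∈ atlas V N) {x : N}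
    (hx : x ∈ e.source) :
    Module.finrank ℝ (LinearMap.ker (bilin (η.inChart e (e x))).toLinearMap) =
      Module.finrank ℝ (kerAt η x) := by
  let A : V ≃ₗ[ℝ] V := LinearEquiv.ofBijective (derivAt V V e.symm (e x)).toLinearMap
    (derivAt_chart_symm_bijective he (e.map_source hx))
  have h : (LinearMap.ker (bilin (η.inChart e (e x))).toLinearMap).map A.toLinearMap =
      kerAt η x := by
    ext v
    obtain ⟨u, rfl⟩ := A.surjective v
    have h1 : A u ∈ kerAt η x ↔ _ := derivAt_chart_symm_mem_kerAt_iff η he hx u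
    rw [h1]
    constructor
    · rintro ⟨u', hu', huu'⟩
      obtain rfl : u' = u := A.injective huu'
      exact hu'
    · exact fun hu ↦ ⟨u, hu, rfl⟩
  exact (A.submoduleMap _).finrank_eq.trans (by rw [h])

end Charts

/-! ### Pullbacks of presymplectic forms. -/

section Pullback

variable {W V : Type*} [NormedAddCommGroup W] [NormedSpace ℝ W]
  [NormedAddCommGroup V] [NormedSpace ℝ V]
  {P N : Type*} [TopologicalSpace P] [ChartedSpace W P] [TopologicalSpace N] [ChartedSpace V N]
  [IsManifold 𝓘(ℝ, W) ∞ P] [IsManifold 𝓘(ℝ, V) ∞ N]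

/-- By the chain rule, pulling back commutes with passing to charts, so closedness of the pullback
reduces to `extDeriv_pullback` on vector spaces. -/
theorem inChart_pullback (η : TwoForm V N) {f : P → N} (hf : ContMDiff 𝓘(ℝ, W) 𝓘(ℝ, V) ∞ f)
    {e : OpenPartialHomeomorph P W} (he : e ∈ atlas W P) {c : OpenPartialHomeomorph N V}
    (hc : c ∈ atlas V N) {y : W} (hy : y ∈ e.target) (hfy : f (e.symm y) ∈ c.source) :
    (η.pullback (W := W) f).inChart e y =
      (η.inChart c ((c ∘ f ∘ e.symm) y)).compContinuousLinearMap
        (fderiv ℝ (c ∘ f ∘ e.symm) y) := by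
  have hfd : MDifferentiable 𝓘(ℝ, W) 𝓘(ℝ, V) f := hf.mdifferentiable (by simp)
  have hed := (mdifferentiable_chart_of_mem_atlas he).mdifferentiableAt_symm hy
  have h1 := derivAt_chart_symm_comp_derivAt (W := W) (f := f ∘ e.symm) (x := y) hc hfy
    ((hfd _).comp y hed)
  rw [derivAt_comp (hfd _) hed, derivAt_eq_fderiv] at h1
  have h2 : (η.pullback (W := W) f).inChart e y =
      (formAt η (f (e.symm y))).compContinuousLinearMap
        ((derivAt W V f (e.symm y)).comp (derivAt W W e.symm y)) := rfl
  rw [h2, ← h1]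
  change _ = (η.inChart c (c (f (e.symm y)))).compContinuousLinearMap _
  rw [inChart_apply η c hfy]
  rfl

theorem contDiffAt_chart_comp {f : P → N} (hf : ContMDiff 𝓘(ℝ, W) 𝓘(ℝ, V) ∞ f)
    {e : OpenPartialHomeomorph P W} (he : e ∈ atlas W P) {c : OpenPartialHomeomorph N V}
    (hc : c ∈ atlas V N) {y : W} (hy : y ∈ e.target) (hfy : f (e.symm y) ∈ c.source) :
    ContDiffAt ℝ ∞ (c ∘ f ∘ e.symm) y := by
  rw [← contMDiffAt_iff_contDiffAt]
  have h1 := (contMDiffOn_of_mem_maximalAtlas (I := 𝓘(ℝ, V)) (n := ∞)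
    (IsManifold.subset_maximalAtlas hc)).contMDiffAt (c.open_source.mem_nhds hfy)
  have h2 := (contMDiffOn_symm_of_mem_maximalAtlas (I := 𝓘(ℝ, W)) (n := ∞)
    (IsManifold.subset_maximalAtlas he)).contMDiffAt (e.open_target.mem_nhds hy)
  exact h1.comp y (hf.contMDiffAt.comp y h2)

/-- The pullback of a presymplectic form along a smooth map is presymplectic. -/
theorem IsPresymplecticForm.pullback [FiniteDimensional ℝ V] [FiniteDimensional ℝ W]
    {η : TwoForm V N} (hη : IsPresymplecticForm η) {f : P → N}
    (hf : ContMDiff 𝓘(ℝ, W) 𝓘(ℝ, V) ∞ f) : IsPresymplecticForm (η.pullback (W := W) f) := by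
  have key : ∀ e ∈ atlas W P, ∀ y ∈ e.target,
      ContDiffAt ℝ ∞ ((η.pullback (W := W) f).inChart e) y ∧
      extDeriv ((η.pullback (W := W) f).inChart e) y = 0 := by
    intro e he y hy
    set c := chartAt V (f (e.symm y)) with hcdef
    have hc : c ∈ atlas V N := chart_mem_atlas V _
    have hfy : f (e.symm y) ∈ c.source := mem_chart_source V _
    have hev : ∀ᶠ y' in nhds y, f (e.symm y') ∈ c.source :=
      (hf.continuous.continuousAt.comp (e.continuousAt_symm hy)).eventually
        (c.open_source.mem_nhds hfy)
    have heq : (η.pullback (W := W) f).inChart e =ᶠ[nhds y] fun y ↦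
        (η.inChart c ((c ∘ f ∘ e.symm) y)).compContinuousLinearMap
          (fderiv ℝ (c ∘ f ∘ e.symm) y) := by
      filter_upwards [hev, e.open_target.mem_nhds hy] with y' h1 h2
        using inChart_pullback η hf he hc h2 h1
    have hg := contDiffAt_chart_comp hf he hc hy hfy
    have hgt : (c ∘ f ∘ e.symm) y ∈ c.target := c.map_source hfy
    have hηc : ContDiffAt ℝ ∞ (η.inChart c) ((c ∘ f ∘ e.symm) y) :=
      (hη.smooth c hc).contDiffAt (c.open_target.mem_nhds hgt)
    constructor
    · refine ContDiffAt.congr_of_eventuallyEq ?_ heq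
      exact contDiffAt_compContinuousLinearMap (hηc.comp y hg) (hg.fderiv_right (by simp))
    · rw [heq.extDeriv_eq, extDeriv_pullback (hηc.differentiableAt (by simp)) hg (by
          rw [minSmoothness_of_isRCLikeNormedField]
          exact ENat.LEInfty.out),
        hη.closed c hc _ hgt]
      rfl
  exact ⟨fun e he y hy ↦ (key e he y hy).1.contDiffWithinAt, fun e he y hy ↦ (key e he y hy).2⟩

end Pullback

/-! ### Local left inverses of immersions. -/

section Immersion

variable {W V : Type*} [NormedAddCommGroup W] [NormedSpace ℝ W]
  [NormedAddCommGroup V] [NormedSpace ℝ V]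
  {P N : Type*} [TopologicalSpace P] [ChartedSpace W P] [TopologicalSpace N] [ChartedSpace V N]

/-- An immersion has a local left inverse in a chart. -/
theorem exists_chart_leftInverse_of_isImmersionAt {f : P → N} {x : P}
    (hf : IsImmersionAt 𝓘(ℝ, W) 𝓘(ℝ, V) ∞ f x) :
    ∃ c ∈ IsManifold.maximalAtlas 𝓘(ℝ, W) ∞ P, x ∈ c.source ∧ ∃ ρ : N → W,
      MDifferentiableAt 𝓘(ℝ, V) 𝓘(ℝ, W) ρ (f x) ∧ ∀ y ∈ c.source, ρ (f y) = c y := by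
  refine ⟨hf.domChart, hf.domChart_mem_maximalAtlas, hf.mem_domChart_source,
    fun z ↦ (hf.equiv.symm (hf.codChart z)).1, ?_, fun y hy ↦ ?_⟩
  · have h1 : MDifferentiableAt 𝓘(ℝ, V) 𝓘(ℝ, V) hf.codChart (f x) :=
      ((contMDiffOn_of_mem_maximalAtlas hf.codChart_mem_maximalAtlas).contMDiffAt
        (hf.codChart.open_source.mem_nhds hf.mem_codChart_source)).mdifferentiableAt (by simp)
    have h2 : MDifferentiableAt 𝓘(ℝ, V) 𝓘(ℝ, W) (fun v : V ↦ (hf.equiv.symm v).1)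
        (hf.codChart (f x)) := by
      rw [mdifferentiableAt_iff_differentiableAt]
      fun_prop
    exact h2.comp (f x) h1
  · have hy' : hf.domChart y ∈ (hf.domChart.extend 𝓘(ℝ, W)).target := by
      rw [OpenPartialHomeomorph.extend_target]
      simpa using hf.domChart.map_source hy
    have h1 := hf.writtenInCharts hy'
    simp only [OpenPartialHomeomorph.extend_coe, OpenPartialHomeomorph.extend_coe_symm,
      modelWithCornersSelf_coe, modelWithCornersSelf_coe_symm, Function.id_comp,
      Function.comp_id, Function.comp_apply, hf.domChart.left_inv hy] at h1
    simp [h1]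

/-- Near `x` the map `c.symm ∘ ρ ∘ f` is the identity, so the chain rule gives a left inverse of the
derivative. -/
theorem derivAt_injective_of_isImmersionAt {f : P → N} {x : P}
    (hf : IsImmersionAt 𝓘(ℝ, W) 𝓘(ℝ, V) ∞ f x) : Function.Injective (derivAt W V f x) := by
  obtain ⟨c, hc, hx, ρ, hρ, hρc⟩ := exists_chart_leftInverse_of_isImmersionAt hf
  have hcd : MDifferentiableAt 𝓘(ℝ, W) 𝓘(ℝ, W) c x :=
    ((contMDiffOn_of_mem_maximalAtlas hc).contMDiffAt
      (c.open_source.mem_nhds hx)).mdifferentiableAt (by simp)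
  have hcsd : MDifferentiableAt 𝓘(ℝ, W) 𝓘(ℝ, W) c.symm (c x) :=
    ((contMDiffOn_symm_of_mem_maximalAtlas hc).contMDiffAt
      (c.open_target.mem_nhds (c.map_source hx))).mdifferentiableAt (by simp)
  have hfd : MDifferentiableAt 𝓘(ℝ, W) 𝓘(ℝ, V) f x := hf.contMDiffAt.mdifferentiableAt (by simp)
  have h1 : derivAt W W (c.symm ∘ ρ ∘ f) x = ContinuousLinearMap.id ℝ W := by
    have h2 : derivAt W W (c.symm ∘ ρ ∘ f) x = derivAt W W id x := by
      refine derivAt_congr ?_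
      filter_upwards [c.open_source.mem_nhds hx] with y hy
      simp [hρc y hy, c.left_inv hy]
    rw [h2]
    exact mfderiv_id
  have hρx : (ρ ∘ f) x = c x := hρc x hx
  have hcsd' : MDifferentiableAt 𝓘(ℝ, W) 𝓘(ℝ, W) c.symm ((ρ ∘ f) x) := by rwa [hρx]
  rw [derivAt_comp hcsd' (hρ.comp x hfd), derivAt_comp hρ hfd] at h1
  have h3 : Function.LeftInverse
      ((derivAt W W c.symm ((ρ ∘ f) x)).comp (derivAt V W ρ (f x))) (derivAt W V f x) :=
    fun w ↦ congrArg (fun A : W →L[ℝ] W ↦ A w) h1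
  exact h3.injective

/-- Differentiability of a continuous curve can be tested after composition with an immersion. -/
theorem mdifferentiableAt_of_comp_isImmersionAt {f : P → N} {σ : ℝ → P} {t : ℝ}
    (hf : IsImmersionAt 𝓘(ℝ, W) 𝓘(ℝ, V) ∞ f (σ t)) (hσ : ContinuousAt σ t)
    (hfσ : MDifferentiableAt 𝓘(ℝ, ℝ) 𝓘(ℝ, V) (f ∘ σ) t) :
    MDifferentiableAt 𝓘(ℝ, ℝ) 𝓘(ℝ, W) σ t := by
  obtain ⟨c, hc, hx, ρ, hρ, hρc⟩ := exists_chart_leftInverse_of_isImmersionAt hf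
  have hcsd : MDifferentiableAt 𝓘(ℝ, W) 𝓘(ℝ, W) c.symm (ρ (f (σ t))) := by
    rw [hρc _ hx]
    exact ((contMDiffOn_symm_of_mem_maximalAtlas hc).contMDiffAt
      (c.open_target.mem_nhds (c.map_source hx))).mdifferentiableAt (by simp)
  have h1 : MDifferentiableAt 𝓘(ℝ, ℝ) 𝓘(ℝ, W) (c.symm ∘ ρ ∘ f ∘ σ) t :=
    hcsd.comp t (hρ.comp t hfσ)
  refine h1.congr_of_eventuallyEq ?_
  filter_upwards [hσ.eventually (c.open_source.mem_nhds hx)] with s hs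
  simp [hρc _ hs, c.left_inv hs]

end Immersion

/-! ### Hamilton's equation on a symplectic manifold. -/

section Symplectic

variable {V : Type*} [NormedAddCommGroup V] [NormedSpace ℝ V] [FiniteDimensional ℝ V]
  {N : Type*} [TopologicalSpace N] [ChartedSpace V N] [IsManifold 𝓘(ℝ, V) ∞ N]
  {η : TwoForm V N} {H : N → ℝ} {e : OpenPartialHomeomorph N V}

/-- The Hamiltonian vector field of `H` in the chart `e`. -/
def chartField (η : TwoForm V N) (H : N → ℝ) (e : OpenPartialHomeomorph N V) (y : V) : V :=
  (bilin (η.inChart e y)).inverse (fderiv ℝ (H ∘ e.symm) y)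

theorem IsSymplecticForm.isInvertible_bilin (hη : IsSymplecticForm η) (he : e ∈ atlas V N) {y : V}
    (hy : y ∈ e.target) : (bilin (η.inChart e y)).IsInvertible := by
  have hinj : Function.Injective (bilin (η.inChart e y)) := by
    rw [injective_iff_map_eq_zero]
    intro u hu
    rw [← e.right_inv hy] at hu
    rw [← derivAt_chart_symm_mem_kerAt_iff η he (e.map_target hy), e.right_inv hy] at hu
    have h1 : kerAt η (e.symm y) = ⊥ := hη.nondegenerate _
    rw [h1, Submodule.mem_bot] at hu
    exact (derivAt_chart_symm_bijective he hy).1 (hu.trans (map_zero _).symm)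
  refine ⟨(LinearEquiv.ofInjectiveOfFinrankEq (bilin (η.inChart e y)).toLinearMap hinj
    (finrank_continuousLinearMap_real V).symm).toContinuousLinearEquiv, ?_⟩
  ext u v
  rfl

theorem IsSymplecticForm.eq_chartField_iff (hη : IsSymplecticForm η) (he : e ∈ atlas V N) {y : V}
    (hy : y ∈ e.target) (w : V) :
    bilin (η.inChart e y) w = fderiv ℝ (H ∘ e.symm) y ↔ w = chartField η H e y := by
  obtain ⟨A, hA⟩ := hη.isInvertible_bilin he hy
  rw [chartField, ← hA, ContinuousLinearMap.inverse_equiv]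
  exact A.toLinearEquiv.eq_symm_apply.symm

theorem IsSymplecticForm.contDiffOn_chartField (hη : IsSymplecticForm η)
    (hH : ContMDiff 𝓘(ℝ, V) 𝓘(ℝ, ℝ) ∞ H) (he : e ∈ atlas V N) :
    ContDiffOn ℝ ∞ (chartField η H e) e.target := by
  intro y hy
  have h1 : ContDiffAt ℝ ∞ (fun y ↦ (bilin (η.inChart e y)).inverse) y := by
    refine ContDiffAt.comp (g := ContinuousLinearMap.inverse) y
      (hη.isInvertible_bilin he hy).contDiffAt_map_inverse ?_
    exact (contDiffOn_bilin (hη.smooth e he)).contDiffAt (e.open_target.mem_nhds hy)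
  have h2 : ContDiffAt ℝ ∞ (H ∘ e.symm) y := by
    rw [← contMDiffAt_iff_contDiffAt]
    exact hH.contMDiffAt.comp y ((contMDiffOn_symm_of_mem_maximalAtlas (I := 𝓘(ℝ, V)) (n := ∞)
      (IsManifold.subset_maximalAtlas he)).contMDiffAt (e.open_target.mem_nhds hy))
  exact (h1.clm_apply (h2.fderiv_right (by simp))).contDiffWithinAt

/-- Hamilton's equation in a chart. -/
theorem IsSymplecticForm.hamiltonian_iff_hasDerivAt (hη : IsSymplecticForm η)
    (hH : ContMDiff 𝓘(ℝ, V) 𝓘(ℝ, ℝ) ∞ H) (he : e ∈ atlas V N) {γ : ℝ → N} {t : ℝ}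
    (ht : γ t ∈ e.source) (hγ : MDifferentiableAt 𝓘(ℝ, ℝ) 𝓘(ℝ, V) γ t) :
    bilin (formAt η (γ t)) (derivAt ℝ V γ t 1) = derivAt V ℝ H (γ t) ↔
      HasDerivAt (e ∘ γ) (chartField η H e (e (γ t))) t := by
  have hd : DifferentiableAt ℝ (e ∘ γ) t := by
    rw [← mdifferentiableAt_iff_differentiableAt]
    exact ((mdifferentiable_chart_of_mem_atlas he).mdifferentiableAt ht).comp t hγ
  rw [← derivAt_chart_symm_comp_derivAt (W := ℝ) he ht hγ, derivAt_eq_fderiv]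
  change bilin (formAt η (γ t)) (derivAt V V e.symm (e (γ t)) (fderiv ℝ (e ∘ γ) t 1)) = _ ↔ _
  rw [hamiltonian_iff_chart η he ht (hH.mdifferentiable (by simp) _),
    hη.eq_chartField_iff he (e.map_source ht), fderiv_eq_smul_deriv, one_smul]
  constructor
  · intro h
    rw [← h]
    exact hd.hasDerivAt
  · exact fun h ↦ h.deriv

/-- An ordinary differential equation is a total differential equation over `ℝ`, so the Frobenius
theorem applies in a chart and its smoothness statement comes along. -/
theorem IsSymplecticForm.exists_isHamiltonianCurveOn (hη : IsSymplecticForm η)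
    (hH : ContMDiff 𝓘(ℝ, V) 𝓘(ℝ, ℝ) ∞ H) (x : N) (t₀ : ℝ) :
    ∃ ε > 0, ∃ γ : ℝ → N, γ t₀ = x ∧
      ContMDiffOn 𝓘(ℝ, ℝ) 𝓘(ℝ, V) ∞ γ (Ioo (t₀ - ε) (t₀ + ε)) ∧
      IsHamiltonianCurveOn η H γ (Ioo (t₀ - ε) (t₀ + ε)) := by
  set e := chartAt V x with hedef
  have he : e ∈ atlas V N := chart_mem_atlas V x
  have hx : x ∈ e.source := mem_chart_source V x
  have hX := hη.contDiffOn_chartField hH he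
  have hS : ContDiffOn ℝ ∞ (fun q ↦ (ContinuousLinearMap.id ℝ ℝ).smulRight (chartField η H e q))
      e.target :=
    (ContinuousLinearMap.smulRightL ℝ ℝ V (ContinuousLinearMap.id ℝ ℝ)).contDiff.comp_contDiffOn hX
  -- In one variable integrability is automatic: both sides are `u v` times the same vector.
  obtain ⟨r, hr, p, hp0, hp⟩ := exists_hasFDerivAt_comp e.open_target hS (fun q hq u v ↦ by
    have h1 : DifferentiableAt ℝ (chartField η H e) q :=
      (hX.contDiffAt (e.open_target.mem_nhds hq)).differentiableAt (by simp)
    have h2 : fderiv ℝ (fun q ↦ (ContinuousLinearMap.id ℝ ℝ).smulRight (chartField η H e q)) q =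
        (ContinuousLinearMap.smulRightL ℝ ℝ V (ContinuousLinearMap.id ℝ ℝ)).comp
          (fderiv ℝ (chartField η H e) q) :=
      ((ContinuousLinearMap.smulRightL ℝ ℝ V
        (ContinuousLinearMap.id ℝ ℝ)).hasFDerivAt.comp q h1.hasFDerivAt).fderiv
    rw [h2]
    simp [smul_smul, mul_comm]) (e.map_source hx)
  have hpc := contDiffOn_of_hasFDerivAt_comp Metric.isOpen_ball hS (fun u hu ↦ (hp u hu).1)
    fun u hu ↦ (hp u hu).2
  have hmem : ∀ t ∈ Ioo (t₀ - r) (t₀ + r), t - t₀ ∈ Metric.ball (0 : ℝ) r := by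
    intro t ht
    rw [mem_ball_zero_iff, Real.norm_eq_abs, abs_lt]
    constructor <;> linarith [ht.1, ht.2]
  have hsm : ContMDiffOn 𝓘(ℝ, ℝ) 𝓘(ℝ, V) ∞ (fun t ↦ e.symm (p (t - t₀)))
      (Ioo (t₀ - r) (t₀ + r)) := by
    have h1 : ContDiffOn ℝ ∞ (fun t ↦ p (t - t₀)) (Ioo (t₀ - r) (t₀ + r)) :=
      hpc.comp (by fun_prop) hmem
    exact (contMDiffOn_symm_of_mem_maximalAtlas (I := 𝓘(ℝ, V)) (n := ∞)
      (IsManifold.subset_maximalAtlas he)).comp h1.contMDiffOn fun t ht ↦ (hp _ (hmem t ht)).1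
  refine ⟨r, hr, fun t ↦ e.symm (p (t - t₀)), ?_, hsm, ?_⟩
  · simp [hp0, e.left_inv hx]
  · rw [isHamiltonianCurveOn_iff]
    intro t ht
    have hmd := (hsm.contMDiffAt (Ioo_mem_nhds ht.1 ht.2)).mdifferentiableAt (by simp)
    refine ⟨hmd, ?_⟩
    rw [hη.hamiltonian_iff_hasDerivAt hH he (e.map_target (hp _ (hmem t ht)).1) hmd,
      e.right_inv (hp _ (hmem t ht)).1]
    have h1 : HasDerivAt (fun t ↦ p (t - t₀)) (chartField η H e (p (t - t₀))) t := by
      have h2 := (hp _ (hmem t ht)).2.hasDerivAt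
      simpa using h2.comp_sub_const t t₀
    refine h1.congr_of_eventuallyEq ?_
    filter_upwards [Ioo_mem_nhds ht.1 ht.2] with s hs
    exact e.right_inv (hp _ (hmem s hs)).1

theorem IsSymplecticForm.eventuallyEq_of_isHamiltonianCurveOn (hη : IsSymplecticForm η)
    (hH : ContMDiff 𝓘(ℝ, V) 𝓘(ℝ, ℝ) ∞ H) {J : Set ℝ} (hJ : IsOpen J) {γ₁ γ₂ : ℝ → N}
    (h₁ : IsHamiltonianCurveOn η H γ₁ J) (h₂ : IsHamiltonianCurveOn η H γ₂ J) {t : ℝ} (ht : t ∈ J)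
    (heq : γ₁ t = γ₂ t) : γ₁ =ᶠ[nhds t] γ₂ := by
  set e := chartAt V (γ₁ t) with hedef
  have he : e ∈ atlas V N := chart_mem_atlas V _
  have hx : γ₁ t ∈ e.source := mem_chart_source V _
  obtain ⟨K, s, hs, hK⟩ := (((hη.contDiffOn_chartField hH he).contDiffAt
    (e.open_target.mem_nhds (e.map_source hx))).of_le
    (m := 1) (by simp)).exists_lipschitzOnWith
  have hcurve : ∀ γ : ℝ → N, IsHamiltonianCurveOn η H γ J → γ t = γ₁ t →
      (∀ᶠ t' in nhds t, γ t' ∈ e.source) ∧ ∀ᶠ t' in nhds t,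
        HasDerivAt (e ∘ γ) (chartField η H e ((e ∘ γ) t')) t' ∧ (e ∘ γ) t' ∈ s := by
    intro γ hγ hγt
    rw [isHamiltonianCurveOn_iff] at hγ
    have hcont : ContinuousAt γ t := (hγ t ht).1.continuousAt
    have hsrc : ∀ᶠ t' in nhds t, γ t' ∈ e.source :=
      hcont.eventually (e.open_source.mem_nhds (by rwa [hγt]))
    have hes : ∀ᶠ t' in nhds t, (e ∘ γ) t' ∈ s := by
      have h3 : ContinuousAt (e ∘ γ) t :=
        (e.continuousAt (by rwa [hγt])).comp hcont
      refine h3.eventually ?_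
      rw [Function.comp_apply, hγt]
      exact hs
    refine ⟨hsrc, ?_⟩
    filter_upwards [hsrc, hes, hJ.mem_nhds ht] with t' h3 h4 h5
    exact ⟨(hη.hamiltonian_iff_hasDerivAt hH he h3 (hγ t' h5).1).1 (hγ t' h5).2, h4⟩
  obtain ⟨a₁, b₁⟩ := hcurve γ₁ h₁ rfl
  obtain ⟨a₂, b₂⟩ := hcurve γ₂ h₂ heq.symm
  have huniq : e ∘ γ₁ =ᶠ[nhds t] e ∘ γ₂ :=
    ODE_solution_unique_of_eventually (v := fun _ ↦ chartField η H e) (s := fun _ ↦ s)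
      (Filter.Eventually.of_forall fun _ ↦ hK) b₁ b₂ (by simp [heq])
  filter_upwards [a₁, a₂, huniq] with t' h3 h4 h5
  exact e.injOn h3 h4 h5

/-- Times at which the germs agree form an open set, which is closed in `J`: in a Hausdorff space,
curves that differ at a time differ nearby. Connectedness of `J` concludes. -/
theorem IsSymplecticForm.eqOn_of_isHamiltonianCurveOn [T2Space N] (hη : IsSymplecticForm η)
    (hH : ContMDiff 𝓘(ℝ, V) 𝓘(ℝ, ℝ) ∞ H) {J : Set ℝ} (hJ : IsOpen J) (hJc : J.OrdConnected)
    {γ₁ γ₂ : ℝ → N} (h₁ : IsHamiltonianCurveOn η H γ₁ J) (h₂ : IsHamiltonianCurveOn η H γ₂ J)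
    {t₀ : ℝ} (ht₀ : t₀ ∈ J) (heq : γ₁ t₀ = γ₂ t₀) : EqOn γ₁ γ₂ J := by
  have hloc := fun t (ht : t ∈ J) (h : γ₁ t = γ₂ t) ↦
    hη.eventuallyEq_of_isHamiltonianCurveOn hH hJ h₁ h₂ ht h
  set u : Set ℝ := {t | γ₁ =ᶠ[nhds t] γ₂} with hu
  have huo : IsOpen u := isOpen_setOfPred_eventually_nhds
  have hsub : J ⊆ u := by
    refine hJc.isPreconnected.subset_of_closure_inter_subset huo ⟨t₀, ht₀, hloc t₀ ht₀ heq⟩ ?_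
    rintro t ⟨htu, htJ⟩
    refine hloc t htJ ?_
    by_contra hne
    have h3 : ∀ᶠ t' in nhds t, γ₁ t' ≠ γ₂ t' :=
      ((h₁ t htJ).1.continuousAt.prodMk (h₂ t htJ).1.continuousAt).eventually
        (isClosed_diagonal.isOpen_compl.mem_nhds hne)
    obtain ⟨t', h4, h5⟩ := mem_closure_iff_nhds.1 htu _ h3
    exact h4 h5.self_of_nhds
  exact fun t ht ↦ (hsub ht).self_of_nhds

end Symplectic

/-! ### Reduction of the presymplectic equation to the hidden constraint set. -/

section Inclusion

variable {V : Type*} [NormedAddCommGroup V] [NormedSpace ℝ V]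
  {M : Type*} [TopologicalSpace M] [ChartedSpace V M] {ν : TwoForm V M} {H : M → ℝ}

/-- The inclusion of the hidden constraint set. -/
abbrev inclusion (ν : TwoForm V M) (H : M → ℝ) : hiddenConstraintSet ν H → M := Subtype.val

variable {W : Type*} [NormedAddCommGroup W] [NormedSpace ℝ W]
  [ChartedSpace W (hiddenConstraintSet ν H)]

/-- Split a test vector along the direct sum. On its kernel part the left side vanishes, and so does
`dH`, because `dH(x) = ν(X, ·)` for some `X`. Only vectors tangent to the constraint set remain to
be tested. -/
theorem hamiltonian_pullback_iff
    (hcompl : ∀ x : hiddenConstraintSet ν H,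
      IsCompl (LinearMap.range (derivAt W V (inclusion ν H) x).toLinearMap) (kerAt ν (x : M)))
    (hemb : IsSmoothEmbedding 𝓘(ℝ, W) 𝓘(ℝ, V) ∞ (inclusion ν H))
    (hH : ContMDiff 𝓘(ℝ, V) 𝓘(ℝ, ℝ) ∞ H)
    (x : hiddenConstraintSet ν H) (u : W) :
    bilin (formAt (ν.pullback (W := W) (inclusion ν H)) x) u =
        derivAt W ℝ (fun y : hiddenConstraintSet ν H ↦ H y) x ↔
      bilin (formAt ν (x : M)) (derivAt W V (inclusion ν H) x u) = derivAt V ℝ H (x : M) := by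
  have h1 : derivAt W ℝ (fun y : hiddenConstraintSet ν H ↦ H y) x =
      (derivAt V ℝ H (x : M)).comp (derivAt W V (inclusion ν H) x) :=
    derivAt_comp (W := V) (g := H) (f := inclusion ν H) (hH.mdifferentiable (by simp) _)
      (hemb.contMDiff.mdifferentiable (by simp) x)
  rw [h1, formAt_pullback]
  constructor
  · intro h
    obtain ⟨X, hX⟩ := mem_hiddenConstraintSet_iff.1 x.2
    ext v
    obtain ⟨_, ⟨w, rfl⟩, k, hk, rfl⟩ := Submodule.mem_sup.1
      ((hcompl x).sup_eq_top ▸ Submodule.mem_top : v ∈ _ ⊔ _)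
    have h2 := congrArg (fun φ : W →L[ℝ] ℝ ↦ φ w) h
    simp only [bilin_compContinuousLinearMap] at h2
    rw [map_add, map_add, bilin_swap _ _ k, mem_kerAt_iff.1 hk, ← hX, bilin_swap _ _ k,
      mem_kerAt_iff.1 hk, hX]
    simpa using h2
  · intro h
    ext w
    rw [bilin_compContinuousLinearMap, h]
    rfl

/-- The solutions of the presymplectic equation are the solutions of the Hamiltonian equation on
the hidden constraint set. -/
theorem isHamiltonianCurveOn_iff_exists_lift
    (hcompl : ∀ x : hiddenConstraintSet ν H,
      IsCompl (LinearMap.range (derivAt W V (inclusion ν H) x).toLinearMap) (kerAt ν (x : M)))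
    (hemb : IsSmoothEmbedding 𝓘(ℝ, W) 𝓘(ℝ, V) ∞ (inclusion ν H))
    (hH : ContMDiff 𝓘(ℝ, V) 𝓘(ℝ, ℝ) ∞ H) {J : Set ℝ}
    (hJ : IsOpen J) (hJne : J.Nonempty) (γ : ℝ → M) :
    IsHamiltonianCurveOn ν H γ J ↔ ∃ σ : ℝ → hiddenConstraintSet ν H,
      (∀ t ∈ J, (σ t : M) = γ t) ∧
      IsHamiltonianCurveOn (ν.pullback (W := W) (inclusion ν H))
        (fun x : hiddenConstraintSet ν H ↦ H x) σ J := by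
  have hev : ∀ {σ : ℝ → hiddenConstraintSet ν H}, (∀ t ∈ J, (σ t : M) = γ t) → ∀ t ∈ J,
      inclusion ν H ∘ σ =ᶠ[nhds t] γ := by
    intro σ hσ t ht
    filter_upwards [hJ.mem_nhds ht] with s hs using hσ s hs
  have hder : ∀ {σ : ℝ → hiddenConstraintSet ν H}, (∀ t ∈ J, (σ t : M) = γ t) → ∀ t ∈ J,
      MDifferentiableAt 𝓘(ℝ, ℝ) 𝓘(ℝ, W) σ t →
      derivAt ℝ V γ t 1 = derivAt W V (inclusion ν H) (σ t) (derivAt ℝ W σ t 1) := by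
    intro σ hσ t ht hd
    rw [← derivAt_congr (hev hσ t ht),
      derivAt_comp (W := W) (hemb.contMDiff.mdifferentiable (by simp) _) hd]
    rfl
  constructor
  · intro h
    rw [isHamiltonianCurveOn_iff] at h
    have hmem : ∀ t ∈ J, γ t ∈ hiddenConstraintSet ν H := fun t ht ↦
      mem_hiddenConstraintSet_iff.2 ⟨_, (h t ht).2⟩
    classical
    obtain ⟨s₀, hs₀⟩ := hJne
    -- Outside `J` the lift takes the junk value `γ s₀`, which is why `J` must be nonempty.
    let σ : ℝ → hiddenConstraintSet ν H := fun t ↦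
      if ht : t ∈ J then ⟨γ t, hmem t ht⟩ else ⟨γ s₀, hmem s₀ hs₀⟩
    have hσ : ∀ t ∈ J, (σ t : M) = γ t := fun t ht ↦ by simp [σ, ht]
    refine ⟨σ, hσ, ?_⟩
    rw [isHamiltonianCurveOn_iff]
    intro t ht
    have hc : ContinuousAt σ t := by
      rw [hemb.isEmbedding.isInducing.continuousAt_iff]
      exact (h t ht).1.continuousAt.congr (hev hσ t ht).symm
    have hd : MDifferentiableAt 𝓘(ℝ, ℝ) 𝓘(ℝ, W) σ t :=
      mdifferentiableAt_of_comp_isImmersionAt (hemb.isImmersion.isImmersionAt (σ t)) hc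
        ((h t ht).1.congr_of_eventuallyEq (hev hσ t ht))
    refine ⟨hd, (hamiltonian_pullback_iff hcompl hemb hH _ _).2 ?_⟩
    rw [← hder hσ t ht hd, hσ t ht]
    exact (h t ht).2
  · rintro ⟨σ, hσ, h⟩
    rw [isHamiltonianCurveOn_iff] at h ⊢
    intro t ht
    obtain ⟨h1, h2⟩ := h t ht
    refine ⟨((hemb.contMDiff.mdifferentiable (by simp) _).comp t h1).congr_of_eventuallyEq
      (hev hσ t ht).symm, ?_⟩
    rw [hamiltonian_pullback_iff hcompl hemb hH, ← hder hσ t ht h1, hσ t ht] at h2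
    exact h2

end Inclusion

/-! ### Geometry of the hidden constraint set. -/

section HiddenConstraint

variable {V : Type*} [NormedAddCommGroup V] [NormedSpace ℝ V]
  {M : Type*} [TopologicalSpace M] [ChartedSpace V M] [IsManifold 𝓘(ℝ, V) ∞ M]
  {ν : TwoForm V M} {H : M → ℝ} {m : ℕ}

theorem contDiffOn_comp_chart_symm (hH : ContMDiff 𝓘(ℝ, V) 𝓘(ℝ, ℝ) ∞ H)
    {e : OpenPartialHomeomorph M V} (he : e ∈ atlas V M) :
    ContDiffOn ℝ ∞ (H ∘ e.symm) e.target := by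
  rw [← contMDiffOn_iff_contDiffOn]
  exact hH.comp_contMDiffOn (contMDiffOn_symm_of_mem_maximalAtlas
    (IsManifold.subset_maximalAtlas he))

/-- An integral manifold of the kernel in a chart is a plaque. -/
theorem isPlaque_chart_symm_comp {e : OpenPartialHomeomorph M V} (he : e ∈ atlas V M)
    {S : V → EuclideanSpace ℝ (Fin m) →L[ℝ] V} {π : V →L[ℝ] EuclideanSpace ℝ (Fin m)} {Ω : Set V}
    (hS : IsKernelFrame (fun q ↦ bilin (ν.inChart e q)) S π Ω) (hΩ : Ω ⊆ e.target) {r : ℝ}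
    (hr : 0 < r) {p : EuclideanSpace ℝ (Fin m) → V}
    (hpΩ : ∀ u ∈ Metric.ball (0 : EuclideanSpace ℝ (Fin m)) r, p u ∈ Ω)
    (hp : ∀ u ∈ Metric.ball (0 : EuclideanSpace ℝ (Fin m)) r, HasFDerivAt p (S (p u)) u)
    (hpc : ContDiffOn ℝ ∞ p (Metric.ball 0 r)) (hpi : InjOn p (Metric.ball 0 r)) :
    IsPlaque ν (Metric.ball (0 : EuclideanSpace ℝ (Fin m)) r) (e.symm ∘ p) := by
  have hder : ∀ u ∈ Metric.ball (0 : EuclideanSpace ℝ (Fin m)) r,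
      derivAt (EuclideanSpace ℝ (Fin m)) V (e.symm ∘ p) u =
        (derivAt V V e.symm (p u)).comp (S (p u)) := by
    intro u hu
    rw [derivAt_comp ((mdifferentiable_chart_of_mem_atlas he).mdifferentiableAt_symm
      (hΩ (hpΩ u hu))) (hp u hu).differentiableAt.mdifferentiableAt, derivAt_eq_fderiv,
      (hp u hu).fderiv]
  refine ⟨Metric.isOpen_ball, ⟨⟨0, Metric.mem_ball_self hr⟩, (convex_ball _ _).isPreconnected⟩,
    ?_, ?_, ?_, ?_⟩
  · exact e.symm.injOn.comp hpi fun u hu ↦ hΩ (hpΩ u hu)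
  · exact (contMDiffOn_symm_of_mem_maximalAtlas (IsManifold.subset_maximalAtlas he)).comp
      hpc.contMDiffOn fun u hu ↦ hΩ (hpΩ u hu)
  · intro u hu
    change Function.Injective (derivAt (EuclideanSpace ℝ (Fin m)) V (e.symm ∘ p) u)
    rw [hder u hu]
    exact (derivAt_chart_symm_bijective he (hΩ (hpΩ u hu))).1.comp (hS.injective (hpΩ u hu))
  · intro u hu
    change LinearMap.range (derivAt (EuclideanSpace ℝ (Fin m)) V (e.symm ∘ p) u).toLinearMap =
      kerAt ν (e.symm (p u))
    rw [hder u hu]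
    have hx := e.map_target (hΩ (hpΩ u hu))
    have hq := e.right_inv (hΩ (hpΩ u hu))
    ext v
    obtain ⟨w, rfl⟩ := (derivAt_chart_symm_bijective he (hΩ (hpΩ u hu))).2 v
    have h1 := derivAt_chart_symm_mem_kerAt_iff ν he hx w
    rw [hq] at h1
    rw [h1]
    constructor
    · rintro ⟨κ, hκ⟩
      have h2 : S (p u) κ = w := (derivAt_chart_symm_bijective he (hΩ (hpΩ u hu))).1 hκ
      rw [← h2]
      exact hS.apply_eq_zero _ (hpΩ u hu) κ
    · intro hw
      refine ⟨π w, ?_⟩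
      change derivAt V V e.symm (p u) (S (p u) (π w)) = _
      rw [hS.apply_proj _ (hpΩ u hu) w hw]

variable [FiniteDimensional ℝ V]

/-- Around each of its points, the hidden constraint set is, in a chart, the zero set of a map
that is submersive along the kernel. -/
theorem exists_local_defining_map (hν : IsPresymplecticForm ν)
    (hrank : ∀ x : M, Module.finrank ℝ (kerAt ν x) = m)
    (hH : ContMDiff 𝓘(ℝ, V) 𝓘(ℝ, ℝ) ∞ H) (hnondeg : LeafwiseNondegenerate ν m H)
    {x : M} (hx : x ∈ hiddenConstraintSet ν H) {e : OpenPartialHomeomorph M V}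
    (he : e ∈ atlas V M) (hxe : x ∈ e.source) :
    ∃ (S : V → EuclideanSpace ℝ (Fin m) →L[ℝ] V) (π : V →L[ℝ] EuclideanSpace ℝ (Fin m))
      (Ω : Set V) (G : V → EuclideanSpace ℝ (Fin m) →L[ℝ] ℝ), Ω ⊆ e.target ∧ e x ∈ Ω ∧
      IsKernelFrame (fun q ↦ bilin (ν.inChart e q)) S π Ω ∧ ContDiffOn ℝ ∞ G Ω ∧
      (∀ q ∈ Ω, e.symm q ∈ hiddenConstraintSet ν H ↔ G q = 0) ∧
      ∀ a, (∀ b, fderiv ℝ G (e x) (S (e x) a) b = 0) → a = 0 := by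
  have hω := hν.smooth e he
  obtain ⟨S, π, Ω, hΩ, hxΩ, hS⟩ := exists_isKernelFrame (K := EuclideanSpace ℝ (Fin m))
    e.open_target (contDiffOn_bilin hω) (fun q u ↦ bilin_self _ u) (fun q hq ↦ by
      have h1 := finrank_ker_bilin_inChart ν he (e.map_target hq)
      rw [e.right_inv hq, hrank] at h1
      rw [h1, finrank_euclideanSpace_fin]) (e.map_source hxe)
  have hsymm := fun q hq u v ↦ hS.fderiv_apply_symm e.open_target hΩ hω (hν.closed e he)
    (q := q) hq u v
  have hh := contDiffOn_comp_chart_symm hH he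
  have hG : ContDiffOn ℝ ∞ (fun q ↦ (fderiv ℝ (H ∘ e.symm) q).comp (S q)) Ω :=
    ((hh.mono hΩ).fderiv_of_isOpen hS.isOpen (by simp)).clm_comp hS.smooth
  have hiff : ∀ q ∈ Ω, e.symm q ∈ hiddenConstraintSet ν H ↔
      (fderiv ℝ (H ∘ e.symm) q).comp (S q) = 0 := by
    intro q hq
    have h1 := mem_hiddenConstraintSet_iff_chart ν he (e.map_target (hΩ hq))
      (hH.mdifferentiable (by simp) (e.symm q))
    rw [e.right_inv (hΩ hq), exists_eq_iff_forall_ker fun u v ↦ bilin_swap _ u v] at h1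
    rw [h1]
    constructor
    · intro h
      ext κ
      exact h _ (hS.apply_eq_zero q hq κ)
    · intro h u hu
      rw [← hS.apply_proj q hq u hu]
      exact congrArg (fun φ : EuclideanSpace ℝ (Fin m) →L[ℝ] ℝ ↦ φ (π u)) h
  refine ⟨S, π, Ω, fun q ↦ (fderiv ℝ (H ∘ e.symm) q).comp (S q), hΩ, hxΩ, hS, hG, hiff, ?_⟩
  obtain ⟨r, hr, p, hp0, hpΩ, hp, hpc, hpi⟩ := hS.exists_integralManifold hsymm hxΩ
  have hplaque := isPlaque_chart_symm_comp he hS hΩ hr hpΩ hp hpc hpi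
  have h0 : (0 : EuclideanSpace ℝ (Fin m)) ∈ Metric.ball (0 : EuclideanSpace ℝ (Fin m)) r :=
    Metric.mem_ball_self hr
  -- The plaque is a one-link chain, so it lies in the leaf through its own centre.
  have hleaf : (e.symm ∘ p) '' Metric.ball 0 r ⊆ leaf ν m (e.symm (p 0)) := fun y hy ↦
    Relation.EqvGen.rel _ _ ⟨_, _, hplaque, mem_image_of_mem _ h0, hy⟩
  have hcrit := hnondeg _ _ _ hplaque hleaf 0 h0
  obtain ⟨h1, h2⟩ := hS.fderiv_fderiv_comp (hh.mono hΩ) hr hpΩ hp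
  rw [hp0] at h1 h2
  -- Membership of `x` in the constraint set says precisely that the centre is a critical point on
  -- the plaque.
  have h3 : fderiv ℝ (H ∘ e.symm ∘ p) 0 = 0 := by
    refine h1.trans ((hiff _ hxΩ).1 ?_)
    rwa [e.left_inv hxe]
  intro a ha
  exact hcrit h3 a fun b ↦ (h2 a b).trans (ha b)

theorem exists_isSliceChart (hν : IsPresymplecticForm ν)
    (hrank : ∀ x : M, Module.finrank ℝ (kerAt ν x) = m)
    (hH : ContMDiff 𝓘(ℝ, V) 𝓘(ℝ, ℝ) ∞ H) (hnondeg : LeafwiseNondegenerate ν m H)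
    {W : Type*} [NormedAddCommGroup W] [NormedSpace ℝ W] [FiniteDimensional ℝ W]
    (hdim : Module.finrank ℝ W = Module.finrank ℝ V - m)
    {x : M} (hx : x ∈ hiddenConstraintSet ν H) :
    ∃ (Φ : OpenPartialHomeomorph M V) (L : (W × EuclideanSpace ℝ (Fin m)) ≃L[ℝ] V),
      x ∈ Φ.source ∧ IsSliceChart (hiddenConstraintSet ν H) Φ L := by
  set e := chartAt V x with hedef
  have he : e ∈ atlas V M := chart_mem_atlas V x
  have hxe : x ∈ e.source := mem_chart_source V x
  obtain ⟨S, π, Ω, G, hΩ, hxΩ, hS, hG, hiff, hnd⟩ :=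
    exists_local_defining_map hν hrank hH hnondeg hx he hxe
  -- The subtraction in `hdim` is truncated; `m ≤ dim V` holds because a kernel of dimension `m`
  -- exists at `x`.
  have hdim' : Module.finrank ℝ V =
      Module.finrank ℝ W + Module.finrank ℝ (EuclideanSpace ℝ (Fin m)) := by
    have h1 := (kerAt ν x).finrank_le
    rw [hrank x] at h1
    rw [finrank_euclideanSpace_fin]
    omega
  obtain ⟨φ, hxφ, hφΩ, hφ, hφs, hφG⟩ := hS.exists_straightening hG hxΩ hnd W hdim'
  let L : (W × EuclideanSpace ℝ (Fin m)) ≃L[ℝ] V := (LinearEquiv.ofFinrankEq _ _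
    (by rw [Module.finrank_prod, hdim'])).toContinuousLinearEquiv
  let Φ : OpenPartialHomeomorph M V := e ≫ₕ φ ≫ₕ L.toHomeomorph.toOpenPartialHomeomorph
  have hsrc : ∀ y ∈ Φ.source, y ∈ e.source ∧ e y ∈ φ.source := fun y hy ↦ ⟨hy.1, hy.2.1⟩
  have htgt : ∀ z ∈ Φ.target, L.symm z ∈ φ.target ∧ φ.symm (L.symm z) ∈ e.target :=
    fun z hz ↦ ⟨hz.1.2, hz.2⟩
  have hemax : e ∈ IsManifold.maximalAtlas 𝓘(ℝ, V) ∞ M := IsManifold.subset_maximalAtlas he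
  refine ⟨Φ, L, ⟨hxe, hxφ, mem_univ _⟩, ?_, fun y hy ↦ ?_⟩
  · refine Φ.mem_maximalAtlas_of_contMDiffOn ?_ ?_
    · exact (L.contDiff.comp_contDiffOn hφ).contMDiffOn.comp
        ((contMDiffOn_of_mem_maximalAtlas hemax).mono fun y hy ↦ (hsrc y hy).1)
        fun y hy ↦ (hsrc y hy).2
    · exact (contMDiffOn_symm_of_mem_maximalAtlas hemax).comp
        (hφs.comp L.symm.contDiff.contDiffOn fun z hz ↦ (htgt z hz).1).contMDiffOn
        fun z hz ↦ (htgt z hz).2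
  · obtain ⟨h1, h2⟩ := hsrc y hy
    have h3 : L.symm (Φ y) = φ (e y) := L.symm_apply_apply _
    rw [h3, hφG _ h2, ← hiff _ (hφΩ h2), e.left_inv h1]

variable {W : Type*} [NormedAddCommGroup W] [NormedSpace ℝ W]
  [ChartedSpace W (hiddenConstraintSet ν H)]

/-- The defining map `G` vanishes along the constraint set, so tangent vectors are killed by `dG`,
which is injective on the kernel. The intersection is therefore zero, and dimensions add up. -/
theorem isCompl_range_kerAt (hν : IsPresymplecticForm ν)
    (hrank : ∀ x : M, Module.finrank ℝ (kerAt ν x) = m)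
    (hH : ContMDiff 𝓘(ℝ, V) 𝓘(ℝ, ℝ) ∞ H) (hnondeg : LeafwiseNondegenerate ν m H)
    (hdim : Module.finrank ℝ W = Module.finrank ℝ V - m)
    (hemb : IsSmoothEmbedding 𝓘(ℝ, W) 𝓘(ℝ, V) ∞ (inclusion ν H)) (x : hiddenConstraintSet ν H) :
    IsCompl (LinearMap.range (derivAt W V (inclusion ν H) x).toLinearMap) (kerAt ν (x : M)) := by
  set ι := inclusion ν H with hι
  have hinj := derivAt_injective_of_isImmersionAt (hemb.isImmersion.isImmersionAt x)
  have hιd : MDifferentiable 𝓘(ℝ, W) 𝓘(ℝ, V) ι := hemb.contMDiff.mdifferentiable (by simp)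
  set e := chartAt V (x : M) with hedef
  have he : e ∈ atlas V M := chart_mem_atlas V _
  have hxe : (x : M) ∈ e.source := mem_chart_source V _
  obtain ⟨S, π, Ω, G, hΩ, hxΩ, hS, hG, hiff, hnd⟩ :=
    exists_local_defining_map hν hrank hH hnondeg x.2 he hxe
  have hdisj : Disjoint (LinearMap.range (derivAt W V ι x).toLinearMap) (kerAt ν (x : M)) := by
    rw [Submodule.disjoint_def]
    rintro _ ⟨u, rfl⟩ hu
    change derivAt W V ι x u ∈ kerAt ν (ι x) at hu
    change derivAt W V ι x u = 0
    have hed : MDifferentiableAt 𝓘(ℝ, V) 𝓘(ℝ, V) e (ι x) :=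
      (mdifferentiable_chart_of_mem_atlas he).mdifferentiableAt hxe
    have h1 := derivAt_chart_symm_comp_derivAt (W := W) (f := ι) (x := x) he hxe (hιd x)
    set w := derivAt W V (e ∘ ι) x u with hw
    have h2 : derivAt V V e.symm (e (ι x)) w = derivAt W V ι x u :=
      congrArg (fun A : W →L[ℝ] V ↦ A u) h1
    rw [← h2, derivAt_chart_symm_mem_kerAt_iff ν he hxe] at hu
    have h3 := hS.apply_proj _ hxΩ w hu
    have hGd : DifferentiableAt ℝ G (e (ι x)) :=
      (hG.contDiffAt (hS.isOpen.mem_nhds hxΩ)).differentiableAt (by simp)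
    have hzero : derivAt W (EuclideanSpace ℝ (Fin m) →L[ℝ] ℝ) (G ∘ e ∘ ι) x =
        derivAt W (EuclideanSpace ℝ (Fin m) →L[ℝ] ℝ)
          (fun _ : hiddenConstraintSet ν H ↦ (0 : EuclideanSpace ℝ (Fin m) →L[ℝ] ℝ)) x := by
      refine derivAt_congr ?_
      have hev : ∀ᶠ y in nhds x, ι y ∈ e.source ∧ e (ι y) ∈ Ω := by
        have hc : ContinuousAt ι x := continuous_subtype_val.continuousAt
        have hc' : ContinuousAt (e ∘ ι) x := ContinuousAt.comp (e.continuousAt hxe) hc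
        exact (hc.eventually (e.open_source.mem_nhds hxe)).and
          (hc'.eventually (hS.isOpen.mem_nhds hxΩ))
      filter_upwards [hev] with y hy
      refine (hiff _ hy.2).1 ?_
      rw [e.left_inv hy.1]
      exact y.2
    rw [derivAt_comp (W := V) (g := G) (f := e ∘ ι) hGd.mdifferentiableAt (hed.comp x (hιd x)),
      derivAt_eq_fderiv] at hzero
    have hzero' : derivAt W (EuclideanSpace ℝ (Fin m) →L[ℝ] ℝ)
        (fun _ : hiddenConstraintSet ν H ↦ (0 : EuclideanSpace ℝ (Fin m) →L[ℝ] ℝ)) x = 0 := mfderiv_const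
    rw [hzero'] at hzero
    have h4 : fderiv ℝ G (e (ι x)) w = 0 :=
      congrArg (fun A : W →L[ℝ] EuclideanSpace ℝ (Fin m) →L[ℝ] ℝ ↦ A u) hzero
    have h5 : π w = 0 := hnd _ fun b ↦ by
      rw [h3]
      exact congrArg (fun φ : EuclideanSpace ℝ (Fin m) →L[ℝ] ℝ ↦ φ b) h4
    rw [h5, map_zero] at h3
    rw [← h2, ← h3, map_zero]
  have hmn := (kerAt ν (x : M)).finrank_le
  rw [hrank] at hmn
  have hr : Module.finrank ℝ (LinearMap.range (derivAt W V ι x).toLinearMap) =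
      Module.finrank ℝ W := LinearMap.finrank_range_of_inj hinj
  refine ⟨hdisj, codisjoint_iff.2 (Submodule.eq_top_of_disjoint _ _ ?_ hdisj)⟩
  rw [hr, hrank, hdim]
  omega

theorem isSymplecticForm_pullback_inclusion [FiniteDimensional ℝ W]
    [IsManifold 𝓘(ℝ, W) ∞ (hiddenConstraintSet ν H)]
    (hcompl : ∀ x : hiddenConstraintSet ν H,
      IsCompl (LinearMap.range (derivAt W V (inclusion ν H) x).toLinearMap) (kerAt ν (x : M)))
    (hemb : IsSmoothEmbedding 𝓘(ℝ, W) 𝓘(ℝ, V) ∞ (inclusion ν H))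
    (hν : IsPresymplecticForm ν) :
    IsSymplecticForm (ν.pullback (W := W) (inclusion ν H)) := by
  refine ⟨hν.pullback hemb.contMDiff, fun x ↦ ?_⟩
  change kerAt (ν.pullback (W := W) (inclusion ν H)) x = ⊥
  rw [Submodule.eq_bot_iff]
  intro u hu
  rw [mem_kerAt_iff, formAt_pullback] at hu
  have hinj := derivAt_injective_of_isImmersionAt (hemb.isImmersion.isImmersionAt x)
  refine hinj (Eq.trans ?_ (map_zero _).symm)
  refine Submodule.disjoint_def.1 (hcompl x).disjoint _ ⟨u, rfl⟩ ?_
  rw [mem_kerAt_iff]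
  ext v
  obtain ⟨_, ⟨w, rfl⟩, k, hk, rfl⟩ := Submodule.mem_sup.1
    ((hcompl x).sup_eq_top ▸ Submodule.mem_top : v ∈ _ ⊔ _)
  have h1 := congrArg (fun φ : W →L[ℝ] ℝ ↦ φ w) hu
  simp only [bilin_compContinuousLinearMap] at h1
  rw [map_add, bilin_swap _ _ k, mem_kerAt_iff.1 hk]
  simpa using h1

end HiddenConstraint

end Presymplectic

end

/-! ### The main theorem. -/

theorem mainTheorem1
    {n m : ℕ} {M : Type*} [TopologicalSpace M] [T2Space M]
    [ChartedSpace (EuclideanSpace ℝ (Fin n)) M]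
    [IsManifold 𝓘(ℝ, EuclideanSpace ℝ (Fin n)) ∞ M]
    (ν : Presymplectic.TwoForm (EuclideanSpace ℝ (Fin n)) M)
    (hν : Presymplectic.IsPresymplecticForm ν)
    (hrank : ∀ x : M, Module.finrank ℝ (ν.ker x) = m)
    (H : M → ℝ) (hH : ContMDiff 𝓘(ℝ, EuclideanSpace ℝ (Fin n)) 𝓘(ℝ, ℝ) ∞ H)
    (hnondeg : Presymplectic.LeafwiseNondegenerate ν m H) :
    -- `M_H` is a smooth (embedded) submanifold of `M`
    ∃ _ : ChartedSpace (EuclideanSpace ℝ (Fin (n - m))) (Presymplectic.hiddenConstraintSet ν H),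
      IsManifold 𝓘(ℝ, EuclideanSpace ℝ (Fin (n - m))) ∞ (Presymplectic.hiddenConstraintSet ν H) ∧
      Manifold.IsSmoothEmbedding 𝓘(ℝ, EuclideanSpace ℝ (Fin (n - m)))
        𝓘(ℝ, EuclideanSpace ℝ (Fin n)) ∞
        (Subtype.val : Presymplectic.hiddenConstraintSet ν H → M) ∧
      -- `T_x M = T_x M_H ⊕ ker ν_x` for every `x ∈ M_H`
      (∀ x : Presymplectic.hiddenConstraintSet ν H,
        IsCompl
          (LinearMap.range (mfderiv 𝓘(ℝ, EuclideanSpace ℝ (Fin (n - m)))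
            𝓘(ℝ, EuclideanSpace ℝ (Fin n))
            (Subtype.val : Presymplectic.hiddenConstraintSet ν H → M) x).toLinearMap)
          (ν.ker (x : M))) ∧
      -- the restriction of `ν` to `M_H` is a symplectic form
      Presymplectic.IsSymplecticForm
        (ν.pullback (W := EuclideanSpace ℝ (Fin (n - m)))
                (Subtype.val : Presymplectic.hiddenConstraintSet ν H → M)) ∧
      -- existence of (smooth) solutions for initial data in `M_H`
      (∀ x ∈ Presymplectic.hiddenConstraintSet ν H, ∀ t₀ : ℝ, ∃ ε > 0, ∃ γ : ℝ → M, γ t₀ = x ∧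
        ContMDiffOn 𝓘(ℝ, ℝ) 𝓘(ℝ, EuclideanSpace ℝ (Fin n)) ∞ γ (Set.Ioo (t₀ - ε) (t₀ + ε)) ∧
        Presymplectic.IsHamiltonianCurveOn ν H γ (Set.Ioo (t₀ - ε) (t₀ + ε))) ∧
      -- uniqueness of solutions on every open interval
      (∀ J : Set ℝ, IsOpen J → J.OrdConnected → ∀ t₀ ∈ J, ∀ γ₁ γ₂ : ℝ → M,
        Presymplectic.IsHamiltonianCurveOn ν H γ₁ J → Presymplectic.IsHamiltonianCurveOn ν H γ₂ J →
        γ₁ t₀ = γ₂ t₀ → Set.EqOn γ₁ γ₂ J) ∧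
      -- the solutions are exactly those of the Hamiltonian problem of `H` restricted to `M_H`
      (∀ J : Set ℝ, IsOpen J → J.OrdConnected → J.Nonempty → ∀ γ : ℝ → M,
        Presymplectic.IsHamiltonianCurveOn ν H γ J ↔
          ∃ σ : ℝ → Presymplectic.hiddenConstraintSet ν H,
            (∀ t ∈ J, (σ t : M) = γ t) ∧
            Presymplectic.IsHamiltonianCurveOn
              (ν.pullback (W := EuclideanSpace ℝ (Fin (n - m)))
                (Subtype.val : Presymplectic.hiddenConstraintSet ν H → M))
              (fun x ↦ H (x : M)) σ J) := by
  set E := EuclideanSpace ℝ (Fin n)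
  set W := EuclideanSpace ℝ (Fin (n - m))
  have hrank' : ∀ x : M, Module.finrank ℝ (Presymplectic.kerAt ν x) = m := hrank
  have hdim : Module.finrank ℝ W = Module.finrank ℝ E - m := by
    simp [W, E]
  obtain ⟨inst, hman, hemb⟩ := Presymplectic.exists_isSmoothEmbedding_of_sliceCharts
    fun x : Presymplectic.hiddenConstraintSet ν H ↦
      Presymplectic.exists_isSliceChart hν hrank' hH hnondeg (W := W) hdim x.2
  have hcompl := Presymplectic.isCompl_range_kerAt hν hrank' hH hnondeg hdim hemb
  have hsymp := Presymplectic.isSymplecticForm_pullback_inclusion hcompl hemb hν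
  have hHr : ContMDiff 𝓘(ℝ, W) 𝓘(ℝ, ℝ) ∞
      (fun x : Presymplectic.hiddenConstraintSet ν H ↦ H x) := hH.comp hemb.contMDiff
  have hiff : ∀ J : Set ℝ, IsOpen J → J.Nonempty → ∀ γ : ℝ → M, _ := fun J hJ hJne γ ↦
    Presymplectic.isHamiltonianCurveOn_iff_exists_lift hcompl hemb hH hJ hJne γ
  refine ⟨inst, hman, hemb, hcompl, hsymp, fun x hx t₀ ↦ ?_, fun J hJ hJc t₀ ht₀ γ₁ γ₂ h₁ h₂ h ↦ ?_,
    fun J hJ _ hJne γ ↦ hiff J hJ hJne γ⟩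
  · obtain ⟨ε, hε, σ, hσ, hσs, hσh⟩ := hsymp.exists_isHamiltonianCurveOn hHr ⟨x, hx⟩ t₀
    refine ⟨ε, hε, fun t ↦ σ t, congrArg Subtype.val hσ, hemb.contMDiff.comp_contMDiffOn hσs,
      (hiff _ isOpen_Ioo ⟨t₀, by simpa using hε⟩ _).2 ⟨σ, fun _ _ ↦ rfl, hσh⟩⟩
  · obtain ⟨σ₁, hσ₁, hs₁⟩ := (hiff J hJ ⟨t₀, ht₀⟩ γ₁).1 h₁
    obtain ⟨σ₂, hσ₂, hs₂⟩ := (hiff J hJ ⟨t₀, ht₀⟩ γ₂).1 h₂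
    have heq := hsymp.eqOn_of_isHamiltonianCurveOn hHr hJ hJc hs₁ hs₂ ht₀
      (Subtype.ext (by rw [hσ₁ t₀ ht₀, hσ₂ t₀ ht₀, h]))
    intro t ht
    rw [← hσ₁ t ht, ← hσ₂ t ht, heq ht]
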